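/- Conventions. A Latin square on a finite set $Q$ is a table $L : Q\times Q\to Q$ in which every element of $Q$ appears exactly once in each row and exactly once in each column (equivalently, the Cayley table of a quasigroup on $Q$); its order is $|Q|$. Its Latin square graph $G(L)$ has one vertex for each triple $(a,b,c)\in Q^3$ with $L(a,b)=c$, two distinct triples $(a,b,c)$ and $(x,y,z)$ being adjacent if and only if $a=x$, $b=y$ or $c=z$. A logspace-uniform $\mathsf{AC}^0$ family is a sequence $(C_N)_{N\in\mathbb N}$, where $C_N$ is a Boolean circuit with $N$ input bits (and possibly many output bits) over NOT gates and AND and OR gates of unbounded fan-in, whose depth is $O(1)$ and whose number of gates is $N^{O(1)}$, such that a deterministic Turing machine computes a description of $C_N$ from $1^N$ using $O(\log N)$ work space. A graph on the vertex set $V=\{0,\dots,m-1\}$ is given to a circuit as its adjacency matrix ($m^2$ bits). A Latin square $L'$ on a subset $S\subseteq V$ is written by a circuit as the $m$ bits of the characteristic function of $S$, followed by an $m\times m$ table, each of whose entries is a binary number of $\lceil\log_2 m\rceil$ digits: the entry at $(u,w)$ is $L'(u,w)$ if $u,w\in S$, and $0$ otherwise. Lemma. There is a logspace-uniform $\mathsf{AC}^0$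 family $(C_N)_N$ that recovers a Latin square from every Latin square graph, in the following sense. Let $n\in\mathbb N$, let $L$ be a Latin square of order $n$, and let $G$ be any graph on the vertex set $\{0,\dots,n^2-1\}$ that is isomorphic to $G(L)$. Then, on the adjacency matrix of $G$, the circuit $C_{n^4}$ outputs a Latin square $L'$ of order $n$ with $G(L')\cong G$, whose rows, columns and symbols are indexed by the vertices $x_1,\dots,x_n$ of an $n$-clique $S$ of $G$. -/

import Mathlib

/-! ### Latin squares and their graphs -/

/-- A Latin square whose rows, columns and entries are indexed by `Q` (equivalently, the Cayley
table of a quasigroup on `Q`): every element of `Q` occurs exactly once in each row and in each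
column. A Latin square of order `n` in the narrow sense has `Q = Fin n`. -/
def IsLatinSquare {Q : Type} (L : Q → Q → Q) : Prop :=
  (∀ i, Function.Bijective fun j => L i j) ∧ ∀ j, Function.Bijective fun i => L i j

/-- The Latin square graph: one vertex for each triple `(a, b, c)` with `L a b = c`; two different
triples are adjacent if they agree in at least one position. -/
def latinSquareGraph {Q : Type} (L : Q → Q → Q) :
    SimpleGraph {t : Q × Q × Q // L t.1 t.2.1 = t.2.2} where
  Adj s t := s ≠ t ∧ (s.1.1 = t.1.1 ∨ s.1.2.1 = t.1.2.1 ∨ s.1.2.2 = t.1.2.2)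
  symm := ⟨fun _ _ h =>
    ⟨h.1.symm, h.2.imp Eq.symm fun h' => h'.imp Eq.symm Eq.symm⟩⟩
  loopless := ⟨fun _ h => h.1 rfl⟩

/-! ### Boolean circuits with unbounded fan-in

Gates are labelled by binary words and listed in a topological order. -/

/-- The operation of a gate, with the labels of the gates that feed it. -/
inductive GateOp (N : ℕ) : Type
  | input (i : Fin N)
  | not (a : List Bool)
  | and (as : List (List Bool))
  | or (as : List (List Bool))

/-- The labels of the gates that feed a gate. -/
def GateOp.args {N : ℕ} : GateOp N → List (List Bool)
  | .input _ => []
  | .not a => [a]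
  | .and as => as
  | .or as => as

/-- The value of a gate, from the input string `x` and the values `v` of the gates. -/
def GateOp.eval {N : ℕ} (x : Fin N → Bool) (v : List Bool → Bool) : GateOp N → Bool
  | .input i => x i
  | .not a => !(v a)
  | .and as => as.all v
  | .or as => as.any v

/-- The depth of a gate, from the depths `d` of the gates: input gates have depth `0`, any other
gate is one deeper than the deepest gate that feeds it. -/
def GateOp.depth {N : ℕ} (d : List Bool → ℕ) : GateOp N → ℕ
  | .input _ => 0
  | .not a => d a + 1
  | .and as => (as.map d).foldr max 0 + 1
  | .or as => (as.map d).foldr max 0 + 1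

structure Gate (N : ℕ) : Type where
  label : List Bool
  op : GateOp N

/-- A circuit on `N` input bits: its gates, and the labels of its output gates in order. -/
structure Circuit (N : ℕ) : Type where
  gates : List (Gate N)
  outputs : List (List Bool)

namespace Circuit

variable {N : ℕ}

/-- Gates have different labels, each gate is fed only by gates that stand earlier in the list, and
the outputs are gates of the circuit. -/
def WellFormed (C : Circuit N) : Prop :=
  (C.gates.map Gate.label).Nodup ∧
  (∀ (pre : List (Gate N)) (g : Gate N) (post : List (Gate N)), C.gates = pre ++ g :: post →
    ∀ a ∈ g.op.args, a ∈ pre.map Gate.label) ∧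
  ∀ a ∈ C.outputs, a ∈ C.gates.map Gate.label

/-- The value at each gate label on input `x`, computed along the list of gates. -/
def values (C : Circuit N) (x : Fin N → Bool) : List Bool → Bool :=
  C.gates.foldl (fun v g => Function.update v g.label (g.op.eval x v)) fun _ => false

/-- The output string of the circuit on input `x`. -/
def eval (C : Circuit N) (x : Fin N → Bool) : List Bool :=
  C.outputs.map (C.values x)

/-- The depth of each gate label, computed along the list of gates. -/
def depths (C : Circuit N) : List Bool → ℕ :=
  C.gates.foldl (fun d g => Function.update d g.label (g.op.depth d)) fun _ => 0

/-- The depth of the deepest gate. -/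
def depth (C : Circuit N) : ℕ :=
  (C.gates.map fun g => C.depths g.label).foldr max 0

/-- The number of gates. -/
def size (C : Circuit N) : ℕ :=
  C.gates.length

end Circuit

/-! ### Descriptions of circuits as words over a finite alphabet -/

inductive CircuitSymbol : Type
  | bit (b : Bool)
  | input
  | not
  | and
  | or
  | comma
  | endGate
  | output

/-- Type of the gate, followed by the index of the input bit in binary (least significant bit
first), or by the labels of the gates that feed it. -/
def GateOp.encode {N : ℕ} : GateOp N → List CircuitSymbol
  | .input i => .input :: (Nat.bits i).map .bit
  | .not a => .not :: a.map .bit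
  | .and as => .and :: as.flatMap fun a => a.map .bit ++ [.comma]
  | .or as => .or :: as.flatMap fun a => a.map .bit ++ [.comma]

def Gate.encode {N : ℕ} (g : Gate N) : List CircuitSymbol :=
  g.label.map .bit ++ g.op.encode ++ [.endGate]

/-- The description of a circuit. -/
def Circuit.encode {N : ℕ} (C : Circuit N) : List CircuitSymbol :=
  C.gates.flatMap Gate.encode ++ C.outputs.flatMap fun a => .output :: a.map .bit

/-! ### Deterministic space-bounded Turing machines with output -/

/-- What the head on the read-only input tape can see. -/
inductive InputCell (I : Type) : Type
  | leftEnd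
  | symbol (a : I)
  | rightEnd

inductive HeadMove : Type
  | left
  | stay
  | right

/-- One-way infinite tape: a move to the left from cell `0` has no effect. -/
def HeadMove.apply : HeadMove → ℕ → ℕ
  | .left, p => p - 1
  | .stay, p => p
  | .right, p => p + 1

/-- A deterministic Turing machine with a read-only input tape over the alphabet `I`, finitely many
work tapes and a write-only output tape over the alphabet `O`. -/
structure Transducer (I O : Type) : Type 1 where
  /-- states -/
  Q : Type
  finiteQ : Finite Q
  /-- the initial state -/
  start : Q
  /-- work tapes -/
  K : Type
  finiteK : Finite K
  /-- alphabet of the work tapes -/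
  Γ : Type
  finiteΓ : Finite Γ
  blank : Γ
  /-- From the state, the visible input cell and the visible work cells: halt, or pass to a new
  state, move the input head, write on and move on each work tape, and append a word to the
  output. -/
  δ : Q → InputCell I → (K → Γ) → Option (Q × HeadMove × (K → Γ × HeadMove) × List O)

namespace Transducer

variable {I O : Type} (M : Transducer I O)

structure Config where
  state : M.Q
  inputPos : ℕ
  cells : M.K → ℕ → M.Γ
  heads : M.K → ℕ
  output : List O

/-- The input word `w` stands in the cells `1, …, |w|`, between the end markers in the cells `0`
and `|w| + 1`. -/
def readInput (w : List I) : ℕ → InputCell I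
  | 0 => .leftEnd
  | p + 1 => (w[p]?).elim .rightEnd .symbol

def init : M.Config where
  state := M.start
  inputPos := 0
  cells := fun _ _ => M.blank
  heads := fun _ => 0
  output := []

/-- One step on input `w`; `none` if the machine halts. The input head does not pass the right end
marker. -/
def step (w : List I) (c : M.Config) : Option M.Config :=
  (M.δ c.state (readInput w c.inputPos) fun t => c.cells t (c.heads t)).map fun r =>
    { state := r.1
      inputPos := min (r.2.1.apply c.inputPos) (w.length + 1)
      cells := fun t => Function.update (c.cells t) (c.heads t) (r.2.2.1 t).1
      heads := fun t => (r.2.2.1 t).2.apply (c.heads t)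
      output := c.output ++ r.2.2.2 }

/-- On input `w` the machine halts with output `out`, and it visits only the first `s` cells of
each work tape. -/
def OutputsInSpace (w : List I) (out : List O) (s : ℕ) : Prop :=
  (∃ c, StateTransition.Reaches (M.step w) M.init c ∧ M.step w c = none ∧ c.output = out) ∧
  ∀ c, StateTransition.Reaches (M.step w) M.init c → ∀ t, c.heads t < s

end Transducer

/-! ### Logspace-uniform `AC⁰` -/

/-- Some deterministic logspace Turing machine computes the map `1^N ↦ ⟨C_N⟩`. -/
def LogspaceUniform (C : (N : ℕ) → Circuit N) : Prop :=
  ∃ (M : Transducer Unit CircuitSymbol) (k : ℕ), ∀ N : ℕ,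
    M.OutputsInSpace (List.replicate N ()) (C N).encode (k * (Nat.log 2 N + 1))

/-- `C` is a logspace-uniform family of circuits over unbounded fan-in AND and OR gates and NOT
gates, of constant depth and polynomial size. -/
def IsUniformAC0 (C : (N : ℕ) → Circuit N) : Prop :=
  (∀ N, (C N).WellFormed) ∧
  (∃ d : ℕ, ∀ N, (C N).depth ≤ d) ∧
  (∃ k : ℕ, ∀ N, (C N).size ≤ N ^ k + k) ∧
  LogspaceUniform C

/-! ### Input and output strings -/

open Classical in
/-- The adjacency matrix of a graph on `{0, …, m-1}` as a string of `m²` bits, row by row. -/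
noncomputable def adjacencyString {m : ℕ} (G : SimpleGraph (Fin m)) : Fin (m * m) → Bool :=
  fun i => decide (G.Adj (finProdFinEquiv.symm i).1 (finProdFinEquiv.symm i).2)

/-- The `len` lowest binary digits of `a`, least significant digit first. -/
def binaryDigits (len a : ℕ) : List Bool :=
  (List.range len).map fun b => a.testBit b

open Classical in
/-- The string for a Latin square indexed by a subset `S` of `{0, …, m-1}`: the `m` bits of the
characteristic function of `S`, and then, for the pairs `(u, w)` row by row, the entry in row `u`
and column `w` as a binary number of `⌈log₂ m⌉` digits (all digits are `0` unless
`u, w ∈ S`). -/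
noncomputable def latinSquareString {m : ℕ} (S : Finset (Fin m)) (L : S → S → S) : List Bool :=
  (List.finRange m).map (fun u => decide (u ∈ S)) ++
  (List.finRange m).flatMap fun u => (List.finRange m).flatMap fun w =>
    binaryDigits (Nat.clog 2 m)
      (if h : u ∈ S ∧ w ∈ S then ((L ⟨u, h.1⟩ ⟨w, h.2⟩ : Fin m) : ℕ) else 0)

/-! Geometry. The vertices of the graph are the points of a net with three parallel classes of lines
(rows, columns, symbols), and any two lines of different classes meet in exactly one point. Let `p`
and `q` be adjacent, hence on a common line. Off this line they have only two common neighbours, and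
if `w` is one of these, then `p`, `q`, `w` have no common neighbour except the other one. If `w` is
a third point of the line, then the remaining `n - 3` points of the line are common neighbours of
all three. For `n ≥ 5` these are at least two, so collinearity is first-order definable from
adjacency (`IsNet.onLine_iff`). Two lines are parallel if and only if they are equal or disjoint, so
the relation of lying on a line of a given class is definable too (`IsNet.sameClass_iff`,
`IsNet.thirdClass_iff`).

Recovery. Let `o` be the least vertex, `u` its least neighbour, and `v` its least neighbour off the
line `ou`. The line `ou` is an `n`-clique and serves as index set. A point of it names the column
and the symbol whose lines pass through it. It names a row by projection: the line of the third
class through the point meets the line `ov` in a point `s`, and the row is the line through `s`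
parallel to `ou`. The result is an isotope of the original square with the same graph
(`IsNet.exists_latinSquare_entry`). All this is expressed by formulas in 13 variables with order and
common-digit predicates.

Circuits. A formula becomes a circuit with one gate for each subformula and each assignment of its
variables: OR gates for quantifiers, depth bounded by the height of the formula, and size polynomial
in the number of vertices.

Uniformity. The description of the circuit is printed by a structured program whose registers are
the tracks of a single tape: a cell holds one binary digit of every register. Its elementary
operations and tests are left-to-right passes with one bit of memory, which suffice for counting,
adding, comparing and printing. No pass lengthens the word, so the space is that of the start word,
which has `N.size + 3` digits (`Prog.Exec.pathWithin`, `progMachine_outputsInSpace`).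

For `n < 5` lines need not be definable, but only finitely many graphs occur; formulas look them up
in a table, and the finitely many circuit descriptions are stored in the machine. -/

/-! ### Words of digit vectors -/

/-- The `W` lowest binary digits of a family of numbers, least significant digit first. -/
def digitVecs {ι : Type} : ℕ → (ι → ℕ) → List (ι → Bool)
  | 0, _ => []
  | W + 1, v => (fun x => decide (v x % 2 = 1)) :: digitVecs W fun x => v x / 2

theorem digitVecs_injOn {ι : Type} {W : ℕ} {v v' : ι → ℕ} (h : ∀ x, v x < 2 ^ W)
    (h' : ∀ x, v' x < 2 ^ W) (e : digitVecs W v = digitVecs W v') : v = v' := by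
  induction W generalizing v v' with
  | zero =>
    funext x
    have := h x
    have := h' x
    simp at *
    omega
  | succ W ih =>
    simp only [digitVecs, List.cons.injEq] at e
    have e2 := ih (fun x => by have := h x; rw [pow_succ] at this; omega)
      (fun x => by have := h' x; rw [pow_succ] at this; omega) e.2
    funext x
    have h1 := congrFun e.1 x
    have h2 := congrFun e2 x
    simp only [decide_eq_decide] at h1
    omega

/-- All digits of the values of `c` variables as one binary word. -/
def assignmentWord {c : ℕ} (W : ℕ) (a : Fin c → ℕ) : List Bool :=
  (digitVecs W a).flatMap List.ofFn

theorem length_assignmentWord {c : ℕ} (W : ℕ) (a : Fin c → ℕ) :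
    (assignmentWord W a).length = W * c := by
  unfold assignmentWord
  induction W generalizing a with
  | zero => simp [digitVecs]
  | succ W ih =>
    simp only [digitVecs, List.flatMap_cons, List.length_append, ih, List.length_ofFn]
    ring

theorem assignmentWord_injOn {c W : ℕ} {a a' : Fin c → ℕ} (h : ∀ x, a x < 2 ^ W)
    (h' : ∀ x, a' x < 2 ^ W) (e : assignmentWord W a = assignmentWord W a') : a = a' := by
  refine digitVecs_injOn h h' ?_
  clear h h'
  unfold assignmentWord at e
  induction W generalizing a a' with
  | zero => rfl
  | succ W ih =>
    simp only [digitVecs, List.flatMap_cons] at e ⊢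
    obtain ⟨e1, e2⟩ := List.append_inj e (by simp)
    rw [List.ofFn_inj.1 e1, ih e2]

/-- All assignments that change `a` at the variables of the list `xs` to values below `m`, in
lexicographic order. -/
def assignments {c : ℕ} (m : ℕ) : List (Fin c) → (Fin c → ℕ) → List (Fin c → ℕ)
  | [], a => [a]
  | x :: xs, a => (List.range m).flatMap fun i => assignments m xs (Function.update a x i)

theorem mem_assignments {c m : ℕ} {xs : List (Fin c)} (hx : xs.Nodup) {a b : Fin c → ℕ} :
    b ∈ assignments m xs a ↔ (∀ x ∈ xs, b x < m) ∧ ∀ x, x ∉ xs → b x = a x := by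
  induction xs generalizing a with
  | nil => simp [assignments, funext_iff]
  | cons x xs ih =>
    obtain ⟨hx1, hx2⟩ := List.nodup_cons.1 hx
    simp only [assignments, List.mem_flatMap, List.mem_range, ih hx2]
    constructor
    · rintro ⟨i, hi, h1, h2⟩
      refine ⟨?_, ?_⟩
      · intro y hy
        rcases List.mem_cons.1 hy with rfl | hy
        · rw [h2 _ hx1]; simpa using hi
        · exact h1 _ hy
      · intro y hy
        simp only [List.mem_cons, not_or] at hy
        rw [h2 _ hy.2, Function.update_of_ne hy.1]
    · rintro ⟨h1, h2⟩
      refine ⟨b x, h1 x (by simp), fun y hy => h1 y (by simp [hy]), fun y hy => ?_⟩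
      by_cases h : y = x
      · subst h; simp
      · rw [Function.update_of_ne h]
        exact h2 _ (by simp [h, hy])

theorem nodup_assignments {c m : ℕ} {xs : List (Fin c)} (hx : xs.Nodup) (a : Fin c → ℕ) :
    (assignments m xs a).Nodup := by
  induction xs generalizing a with
  | nil => simp [assignments]
  | cons x xs ih =>
    obtain ⟨hx1, hx2⟩ := List.nodup_cons.1 hx
    simp only [assignments]
    rw [List.nodup_flatMap]
    refine ⟨fun i _ => ih hx2 _, ?_⟩
    refine List.nodup_range.imp fun {i j} hij => ?_
    simp only [Function.onFun, List.disjoint_left]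
    intro b h1 h2
    have e1 := ((mem_assignments hx2).1 h1).2 x hx1
    have e2 := ((mem_assignments hx2).1 h2).2 x hx1
    simp only [Function.update_self] at e1 e2
    exact hij (e1.symm.trans e2)

theorem length_assignments {c m : ℕ} (xs : List (Fin c)) (a : Fin c → ℕ) :
    (assignments m xs a).length = m ^ xs.length := by
  induction xs generalizing a with
  | nil => simp [assignments]
  | cons x xs ih => simp [assignments, List.length_flatMap, ih, pow_succ, mul_comm]

/-- All assignments of values below `m` to `c` variables. -/
def allAssignments (c m : ℕ) : List (Fin c → ℕ) :=
  assignments m (List.finRange c) 0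

theorem mem_allAssignments {c m : ℕ} {a : Fin c → ℕ} :
    a ∈ allAssignments c m ↔ ∀ x, a x < m := by
  simp [allAssignments, mem_assignments (List.nodup_finRange c)]

/-! ### Evaluation along a list of gates -/

section Fold

variable {N : ℕ} {β : Type}

/-- The values at the gate labels after the gates of the list `l` have been evaluated by `F`. -/
def foldGates (F : GateOp N → (List Bool → β) → β) (l : List (Gate N)) (v : List Bool → β) :
    List Bool → β :=
  l.foldl (fun v g => Function.update v g.label (F g.op v)) v

theorem foldGates_append (F : GateOp N → (List Bool → β) → β) (l l' : List (Gate N))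
    (v : List Bool → β) : foldGates F (l ++ l') v = foldGates F l' (foldGates F l v) :=
  List.foldl_append

theorem foldGates_of_notMem (F : GateOp N → (List Bool → β) → β) {l : List (Gate N)}
    (v : List Bool → β) {s : List Bool} (h : s ∉ l.map Gate.label) : foldGates F l v s = v s := by
  induction l generalizing v with
  | nil => rfl
  | cons g l ih =>
    simp only [List.map_cons, List.mem_cons, not_or] at h
    change foldGates F l (Function.update v g.label (F g.op v)) s = v s
    rw [ih _ h.2, Function.update_of_ne h.1]

/-- No gate of the layer is fed by another one of it and every label is written only once, so all
gates see the incoming values `v`. The hypothesis `hF` says that a gate depends only on the labels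
that feed it. -/
theorem foldGates_layer {F : GateOp N → (List Bool → β) → β}
    (hF : ∀ o v v', (∀ a ∈ o.args, v a = v' a) → F o v = F o v') {l : List (Gate N)}
    (hl : (l.map Gate.label).Nodup) (v : List Bool → β)
    (h : ∀ g ∈ l, ∀ a ∈ g.op.args, a ∉ l.map Gate.label) {g : Gate N} (hg : g ∈ l) :
    foldGates F l v g.label = F g.op v := by
  induction l generalizing v with
  | nil => simp at hg
  | cons g' l ih =>
    change foldGates F l (Function.update v g'.label (F g'.op v)) g.label = _
    simp only [List.map_cons, List.nodup_cons] at hl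
    rcases List.mem_cons.1 hg with rfl | hg
    · rw [foldGates_of_notMem F _ hl.1, Function.update_self]
    · rw [ih hl.2 _ (fun k hk a ha hm => h k (by simp [hk]) a ha (by simp [hm])) hg]
      refine hF _ _ _ fun a ha => ?_
      have := h g (by simp [hg]) a ha
      simp only [List.map_cons, List.mem_cons, not_or] at this
      rw [Function.update_of_ne this.1]

theorem GateOp.eval_congr (x : Fin N → Bool) (o : GateOp N) (v v' : List Bool → Bool)
    (h : ∀ a ∈ o.args, v a = v' a) : o.eval x v = o.eval x v' := by
  cases o with
  | input i => rfl
  | not a => simp [GateOp.eval, h a (by simp [GateOp.args])]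
  | and as =>
    simp only [GateOp.eval, GateOp.args] at *
    rw [Bool.eq_iff_iff]; simp only [List.all_eq_true]
    exact forall₂_congr fun a ha => by rw [h a ha]
  | or as =>
    simp only [GateOp.eval, GateOp.args] at *
    rw [Bool.eq_iff_iff]; simp only [List.any_eq_true]
    exact exists_congr fun a => and_congr_right fun ha => by rw [h a ha]

theorem GateOp.depth_congr (o : GateOp N) (v v' : List Bool → ℕ)
    (h : ∀ a ∈ o.args, v a = v' a) : o.depth v = o.depth v' := by
  cases o with
  | input i => rfl
  | not a => simp [GateOp.depth, h a (by simp [GateOp.args])]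
  | and as => simp only [GateOp.depth, GateOp.args] at *; rw [List.map_congr_left h]
  | or as => simp only [GateOp.depth, GateOp.args] at *; rw [List.map_congr_left h]

theorem foldr_max_le {l : List ℕ} {d : ℕ} (h : ∀ a ∈ l, a ≤ d) : l.foldr max 0 ≤ d := by
  induction l with
  | nil => simp
  | cons a l ih =>
    simp only [List.foldr_cons, max_le_iff]
    exact ⟨h a (by simp), ih fun b hb => h b (by simp [hb])⟩

theorem GateOp.depth_le (o : GateOp N) {v : List Bool → ℕ} {d : ℕ}
    (h : ∀ a ∈ o.args, v a ≤ d) : o.depth v ≤ d + 1 := by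
  cases o with
  | input i => simp [GateOp.depth]
  | not a => simpa [GateOp.depth] using h a (by simp [GateOp.args])
  | and as =>
    simp only [GateOp.depth, GateOp.args] at *
    exact Nat.succ_le_succ (foldr_max_le (by simpa using h))
  | or as =>
    simp only [GateOp.depth, GateOp.args] at *
    exact Nat.succ_le_succ (foldr_max_le (by simpa using h))

/-- Each gate of the list is fed by labels in `T` or by earlier gates of the list. -/
def FedBy : Set (List Bool) → List (Gate N) → Prop
  | _, [] => True
  | T, g :: l => (∀ a ∈ g.op.args, a ∈ T) ∧ FedBy (insert g.label T) l

theorem FedBy.mono {T T' : Set (List Bool)} (hT : T ⊆ T') {l : List (Gate N)} (h : FedBy T l) :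
    FedBy T' l := by
  induction l generalizing T T' with
  | nil => trivial
  | cons g l ih => exact ⟨fun a ha => hT (h.1 a ha), ih (Set.insert_subset_insert hT) h.2⟩

theorem FedBy.append {T : Set (List Bool)} {l l' : List (Gate N)} (h : FedBy T l)
    (h' : FedBy (T ∪ {s | s ∈ l.map Gate.label}) l') : FedBy T (l ++ l') := by
  induction l generalizing T with
  | nil => simpa using h'
  | cons g l ih =>
    refine ⟨h.1, ih h.2 (h'.mono ?_)⟩
    intro s
    simp only [List.map_cons, List.mem_cons, Set.mem_union, Set.mem_insert_iff, Set.mem_ofPred_eq]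
    tauto

theorem FedBy.of_forall {T : Set (List Bool)} {l : List (Gate N)}
    (h : ∀ g ∈ l, ∀ a ∈ g.op.args, a ∈ T) : FedBy T l := by
  induction l generalizing T with
  | nil => trivial
  | cons g l ih =>
    exact ⟨h g (by simp), ih fun k hk a ha => Set.mem_insert_of_mem _ (h k (by simp [hk]) a ha)⟩

/-- For `T = ∅` this turns the recursive predicate, which suits concatenation, into the second
clause of `Circuit.WellFormed`. -/
theorem FedBy.mem_of_split {T : Set (List Bool)} {pre post : List (Gate N)} {g : Gate N}
    (h : FedBy T (pre ++ g :: post)) {a : List Bool} (ha : a ∈ g.op.args) :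
    a ∈ T ∨ a ∈ pre.map Gate.label := by
  induction pre generalizing T with
  | nil => exact Or.inl (h.1 a ha)
  | cons k pre ih =>
    rcases ih h.2 with h1 | h1
    · rcases h1 with rfl | h1
      · simp
      · exact Or.inl h1
    · exact Or.inr (by simp only [List.map_cons, List.mem_cons]; exact Or.inr h1)

end Fold

/-! ### First-order formulas over graphs with numerical predicates, and their circuits -/

/-- First-order formulas in the variables `0, …, c - 1` over graphs on `{0, …, m-1}`, with arbitrary
predicates of the numerical values of the variables. -/
inductive Formula (c : ℕ) : Type
  | adj (x y : Fin c)
  | num (p : (Fin c → ℕ) → Bool)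
  | not (φ : Formula c)
  | and (φ ψ : Formula c)
  | ex (x : Fin c) (φ : Formula c)

namespace Formula

variable {c : ℕ}

def eval {m : ℕ} (A : Fin m → Fin m → Prop) : Formula c → (Fin c → Fin m) → Prop
  | adj x y, a => A (a x) (a y)
  | num p, a => p (fun x => a x) = true
  | not φ, a => ¬ φ.eval A a
  | and φ ψ, a => φ.eval A a ∧ ψ.eval A a
  | ex x φ, a => ∃ i, φ.eval A (Function.update a x i)

def height : Formula c → ℕ
  | adj _ _ => 1
  | num _ => 1
  | not φ => φ.height + 1
  | and φ ψ => max φ.height ψ.height + 1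
  | ex _ φ => φ.height + 1

def nodes : Formula c → ℕ
  | adj _ _ => 1
  | num _ => 1
  | not φ => φ.nodes + 1
  | and φ ψ => φ.nodes + ψ.nodes + 1
  | ex _ φ => φ.nodes + 1

end Formula

/-- The number of binary digits that are used for each variable in gate labels. -/
def labelWidth (N : ℕ) : ℕ :=
  N.size + 3

/-- The three digits beyond `N.size` leave room for intermediate values above `N`, such as `i * i +
2 * i ≤ 3 * N` in the computation of the square root. -/
theorem lt_two_pow_labelWidth (N : ℕ) : 8 * N < 2 ^ labelWidth N := by
  have := Nat.lt_size_self N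
  rw [labelWidth, pow_add]
  omega

/-- The label of the gate for the subformula at position `p` under the assignment `a`. -/
def gateLabel {c : ℕ} (N : ℕ) (p : List Bool) (a : Fin c → ℕ) : List Bool :=
  p ++ assignmentWord (labelWidth N) a

theorem length_gateLabel {c : ℕ} (N : ℕ) (p : List Bool) (a : Fin c → ℕ) :
    (gateLabel N p a).length = p.length + labelWidth N * c := by
  simp [gateLabel, length_assignmentWord]

theorem gateLabel_injOn {c N : ℕ} {p : List Bool} {a a' : Fin c → ℕ} (h : ∀ x, a x < N.sqrt)
    (h' : ∀ x, a' x < N.sqrt) (e : gateLabel N p a = gateLabel N p a') : a = a' := by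
  have hN := lt_two_pow_labelWidth N
  have hs := Nat.sqrt_le_self N
  refine assignmentWord_injOn (fun x => ?_) (fun x => ?_) (List.append_cancel_left e)
  · have := h x; omega
  · have := h' x; omega

/-- An empty OR is the constant `false`. It is never needed for entries of the adjacency matrix,
since `x * N.sqrt + y < N` for `x, y < N.sqrt`. -/
def inputOp (N i : ℕ) : GateOp N :=
  if h : i < N then .input ⟨i, h⟩ else .or []

/-- One gate for each assignment. -/
def gateLayer {c : ℕ} (N : ℕ) (p : List Bool) (f : (Fin c → ℕ) → GateOp N) : List (Gate N) :=
  (allAssignments c N.sqrt).map fun a => ⟨gateLabel N p a, f a⟩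

/-! ### Gates of a formula: labels, order, values and depths -/

namespace Formula

variable {c : ℕ}

/-- The operation of the gate for a formula at position `p`. -/
def topOp (N : ℕ) (p : List Bool) : Formula c → (Fin c → ℕ) → GateOp N
  | adj x y, a => inputOp N (a x * N.sqrt + a y)
  | num q, a => if q a then .and [] else .or []
  | not _, a => .not (gateLabel N (p ++ [false]) a)
  | and _ _, a => .and [gateLabel N (p ++ [false]) a, gateLabel N (p ++ [true]) a]
  | ex x _, a => .or ((List.range N.sqrt).map fun i =>
      gateLabel N (p ++ [false]) (Function.update a x i))

/-- The gates for all subformulas of a formula at position `p`. -/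
def gates (N : ℕ) : List Bool → Formula c → List (Gate N)
  | p, adj x y => gateLayer N p (topOp N p (adj x y))
  | p, num q => gateLayer N p (topOp N p (num q))
  | p, not φ => gates N (p ++ [false]) φ ++ gateLayer N p (topOp N p (not φ))
  | p, and φ ψ => gates N (p ++ [false]) φ ++ gates N (p ++ [true]) ψ ++
      gateLayer N p (topOp N p (and φ ψ))
  | p, ex x φ => gates N (p ++ [false]) φ ++ gateLayer N p (topOp N p (ex x φ))

/-- The gates for the proper subformulas of a formula at position `p`. -/
def subGates (N : ℕ) (p : List Bool) : Formula c → List (Gate N)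
  | adj _ _ => []
  | num _ => []
  | not φ => gates N (p ++ [false]) φ
  | and φ ψ => gates N (p ++ [false]) φ ++ gates N (p ++ [true]) ψ
  | ex _ φ => gates N (p ++ [false]) φ

/-- Splits off the last layer, so that well-formedness, values and depths are treated alike for all
connectives. -/
theorem gates_eq (N : ℕ) (p : List Bool) (φ : Formula c) :
    φ.gates N p = φ.subGates N p ++ gateLayer N p (φ.topOp N p) := by
  cases φ <;> simp [gates, subGates]

theorem mem_labels_gateLayer {N : ℕ} {p : List Bool} {f : (Fin c → ℕ) → GateOp N}
    {s : List Bool} : s ∈ (gateLayer N p f).map Gate.label ↔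
      ∃ a : Fin c → ℕ, (∀ x, a x < N.sqrt) ∧ gateLabel N p a = s := by
  simp [gateLayer, mem_allAssignments]

theorem nodup_labels_gateLayer {N : ℕ} {p : List Bool} {f : (Fin c → ℕ) → GateOp N} :
    ((gateLayer N p f).map Gate.label).Nodup := by
  rw [gateLayer, List.map_map]
  refine List.Nodup.map_on ?_ (nodup_assignments (List.nodup_finRange c) 0)
  intro a ha a' ha' e
  exact gateLabel_injOn (mem_allAssignments.1 ha) (mem_allAssignments.1 ha') e

/-- All assignment words have the same length. Hence labels of proper subformulas are longer than
those of the formula itself, and labels below two sibling positions differ in a prefix of equal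
length; this separates all layers. -/
theorem prefix_of_mem_labels {N : ℕ} {p : List Bool} {φ : Formula c} {s : List Bool}
    (h : s ∈ (φ.gates N p).map Gate.label) :
    p <+: s ∧ p.length + labelWidth N * c ≤ s.length := by
  have layer : ∀ {q : List Bool} {f : (Fin c → ℕ) → GateOp N},
      s ∈ (gateLayer N q f).map Gate.label →
        q <+: s ∧ q.length + labelWidth N * c ≤ s.length := by
    intro q f h
    obtain ⟨a, -, rfl⟩ := mem_labels_gateLayer.1 h
    exact ⟨List.prefix_append _ _, by rw [length_gateLabel]⟩
  have child : ∀ {p : List Bool} {b : Bool},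
      (p ++ [b] <+: s ∧ (p ++ [b]).length + labelWidth N * c ≤ s.length) →
      p <+: s ∧ p.length + labelWidth N * c ≤ s.length := by
    rintro p b ⟨h1, h2⟩
    refine ⟨(List.prefix_append _ _).trans h1, ?_⟩
    simp only [List.length_append, List.length_singleton] at h2
    omega
  induction φ generalizing p with
  | adj x y => exact layer h
  | num q => exact layer h
  | not φ ih =>
    simp only [gates, List.map_append, List.mem_append] at h
    rcases h with h | h
    · exact child (ih h)
    · exact layer h
  | and φ ψ ih1 ih2 =>
    simp only [gates, List.map_append, List.mem_append] at h
    rcases h with (h | h) | h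
    · exact child (ih1 h)
    · exact child (ih2 h)
    · exact layer h
  | ex x φ ih =>
    simp only [gates, List.map_append, List.mem_append] at h
    rcases h with h | h
    · exact child (ih h)
    · exact layer h

theorem disjoint_labels {N : ℕ} {p q : List Bool} (hl : p.length = q.length) (hpq : p ≠ q)
    {φ ψ : Formula c} : ((φ.gates N p).map Gate.label).Disjoint ((ψ.gates N q).map Gate.label) := by
  intro s h1 h2
  have e1 := (prefix_of_mem_labels h1).1
  have e2 := (prefix_of_mem_labels h2).1
  exact hpq ((List.prefix_of_prefix_length_le e1 e2 hl.le).eq_of_length hl)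

theorem length_of_mem_subGates {N : ℕ} {p : List Bool} {φ : Formula c} {s : List Bool}
    (h : s ∈ (φ.subGates N p).map Gate.label) : p.length + labelWidth N * c < s.length := by
  have child : ∀ {b : Bool} {ψ : Formula c}, s ∈ (ψ.gates N (p ++ [b])).map Gate.label →
      p.length + labelWidth N * c < s.length := by
    intro b ψ h
    have := (prefix_of_mem_labels h).2
    simp only [List.length_append, List.length_singleton] at this
    omega
  cases φ with
  | adj x y => simp [subGates] at h
  | num q => simp [subGates] at h
  | not φ => exact child h
  | and φ ψ =>
    simp only [subGates, List.map_append, List.mem_append] at h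
    exact h.elim child child
  | ex x φ => exact child h

theorem gateLabel_notMem_subGates {N : ℕ} {p : List Bool} {φ : Formula c} {a : Fin c → ℕ} :
    gateLabel N p a ∉ (φ.subGates N p).map Gate.label := by
  intro h
  have := length_of_mem_subGates h
  rw [length_gateLabel] at this
  omega

theorem gateLabel_mem_gates {N : ℕ} {p : List Bool} {φ : Formula c} {a : Fin c → ℕ}
    (h : ∀ x, a x < N.sqrt) : gateLabel N p a ∈ (φ.gates N p).map Gate.label := by
  rw [gates_eq, List.map_append, List.mem_append]
  exact Or.inr (mem_labels_gateLayer.2 ⟨a, h, rfl⟩)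

theorem mem_subGates_of_mem_args {N : ℕ} {p : List Bool} {φ : Formula c} {a : Fin c → ℕ}
    (ha : ∀ x, a x < N.sqrt) {s : List Bool} (hs : s ∈ (φ.topOp N p a).args) :
    s ∈ (φ.subGates N p).map Gate.label := by
  cases φ with
  | adj x y =>
    simp only [topOp, inputOp] at hs
    split_ifs at hs <;> simp [GateOp.args] at hs
  | num q =>
    simp only [topOp] at hs
    split_ifs at hs <;> simp [GateOp.args] at hs
  | not φ =>
    simp only [topOp, GateOp.args, List.mem_singleton] at hs
    subst hs
    exact gateLabel_mem_gates ha
  | and φ ψ =>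
    simp only [topOp, GateOp.args, List.mem_cons, List.not_mem_nil, or_false] at hs
    simp only [subGates, List.map_append, List.mem_append]
    rcases hs with rfl | rfl
    · exact Or.inl (gateLabel_mem_gates ha)
    · exact Or.inr (gateLabel_mem_gates ha)
  | ex x φ =>
    simp only [topOp, GateOp.args, List.mem_map, List.mem_range] at hs
    obtain ⟨i, hi, rfl⟩ := hs
    refine gateLabel_mem_gates fun y => ?_
    by_cases h : y = x
    · subst h; simpa using hi
    · rw [Function.update_of_ne h]; exact ha y

theorem nodup_labels {N : ℕ} {p : List Bool} {φ : Formula c} :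
    ((φ.gates N p).map Gate.label).Nodup := by
  have key : ∀ {p : List Bool} {φ : Formula c}, ((φ.subGates N p).map Gate.label).Nodup →
      ((φ.gates N p).map Gate.label).Nodup := by
    intro p φ h
    rw [gates_eq, List.map_append]
    refine h.append nodup_labels_gateLayer ?_
    intro s h1 h2
    obtain ⟨a, -, rfl⟩ := mem_labels_gateLayer.1 h2
    exact gateLabel_notMem_subGates h1
  induction φ generalizing p with
  | adj x y => exact key (by simp [subGates])
  | num q => exact key (by simp [subGates])
  | not φ ih => exact key ih
  | and φ ψ ih1 ih2 =>
    refine key ?_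
    simp only [subGates, List.map_append]
    exact ih1.append ih2 (disjoint_labels (by simp) (by simp))
  | ex x φ ih => exact key ih

theorem fedBy_gates {N : ℕ} {p : List Bool} {φ : Formula c} : FedBy ∅ (φ.gates N p) := by
  have key : ∀ {p : List Bool} {φ : Formula c}, FedBy ∅ (φ.subGates N p) →
      FedBy ∅ (φ.gates N p) := by
    intro p φ h
    rw [gates_eq]
    refine h.append (FedBy.of_forall fun g hg a ha => Or.inr ?_)
    simp only [gateLayer, List.mem_map, mem_allAssignments] at hg
    obtain ⟨b, hb, rfl⟩ := hg
    exact mem_subGates_of_mem_args hb ha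
  induction φ generalizing p with
  | adj x y => exact key trivial
  | num q => exact key trivial
  | not φ ih => exact key ih
  | and φ ψ ih1 ih2 => exact key (ih1.append (ih2.mono (Set.empty_subset _)))
  | ex x φ ih => exact key ih

/-- Stated for an arbitrary evaluation rule `F`, so that it serves both for truth values and for
depths. -/
theorem foldGates_gateLabel {N : ℕ} {β : Type} {F : GateOp N → (List Bool → β) → β}
    (hF : ∀ o v v', (∀ a ∈ o.args, v a = v' a) → F o v = F o v') (p : List Bool) (φ : Formula c)
    (v : List Bool → β) {a : Fin c → ℕ} (ha : ∀ x, a x < N.sqrt) :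
    foldGates F (φ.gates N p) v (gateLabel N p a) =
      F (φ.topOp N p a) (foldGates F (φ.subGates N p) v) := by
  rw [gates_eq, foldGates_append]
  refine foldGates_layer hF (nodup_labels_gateLayer) _ ?_
    (g := ⟨gateLabel N p a, φ.topOp N p a⟩) ?_
  · intro g hg s hs hs'
    simp only [gateLayer, List.mem_map, mem_allAssignments] at hg
    obtain ⟨b, hb, rfl⟩ := hg
    obtain ⟨b', -, rfl⟩ := mem_labels_gateLayer.1 hs'
    exact gateLabel_notMem_subGates (mem_subGates_of_mem_args hb hs)
  · simp only [gateLayer, List.mem_map, mem_allAssignments]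
    exact ⟨a, ha, rfl⟩

theorem foldGates_subGates {N : ℕ} {β : Type} (F : GateOp N → (List Bool → β) → β)
    (p : List Bool) (φ : Formula c) (v : List Bool → β) {s : List Bool}
    (hs : s ∈ (φ.subGates N p).map Gate.label) :
    foldGates F (φ.gates N p) v s = foldGates F (φ.subGates N p) v s := by
  rw [gates_eq, foldGates_append]
  refine foldGates_of_notMem F _ fun h => ?_
  obtain ⟨b', -, rfl⟩ := mem_labels_gateLayer.1 h
  exact gateLabel_notMem_subGates hs

/-- The graph on `{0, …, √N - 1}` that an input string describes. -/
def _root_.inputRel {N : ℕ} (x : Fin N → Bool) (u w : Fin N.sqrt) : Prop :=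
  ∃ h : u * N.sqrt + w < N, x ⟨u * N.sqrt + w, h⟩ = true

/-- The initial values `v` are arbitrary because the gates of one subformula may be preceded by
those of another. -/
theorem values_gateLabel {N : ℕ} (x : Fin N → Bool) (p : List Bool) (φ : Formula c)
    (v : List Bool → Bool) (a : Fin c → Fin N.sqrt) :
    foldGates (fun o v => o.eval x v) (φ.gates N p) v (gateLabel N p fun y => a y) = true ↔
      φ.eval (inputRel x) a := by
  induction φ generalizing p v a with
  | adj y z =>
    rw [foldGates_gateLabel (GateOp.eval_congr x) _ _ _ fun y => (a y).2]
    simp only [topOp, inputOp, eval, inputRel]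
    split_ifs with h
    · simp [GateOp.eval, h]
    · simp [GateOp.eval, h]
  | num q =>
    rw [foldGates_gateLabel (GateOp.eval_congr x) _ _ _ fun y => (a y).2]
    simp only [topOp, eval]
    split_ifs with h <;> simp [GateOp.eval, h]
  | not φ ih =>
    rw [foldGates_gateLabel (GateOp.eval_congr x) _ _ _ fun y => (a y).2]
    simp only [topOp, eval, GateOp.eval, subGates, Bool.not_eq_true', ← ih (p ++ [false]) v a,
      Bool.not_eq_true]
  | and φ ψ ih1 ih2 =>
    rw [foldGates_gateLabel (GateOp.eval_congr x) _ _ _ fun y => (a y).2]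
    have e : ∀ (v : List Bool → Bool) (s t : List Bool),
        (GateOp.and [s, t]).eval x v = (v s && v t) := by simp [GateOp.eval]
    simp only [topOp, eval, e, subGates, Bool.and_eq_true, foldGates_append, ih2]
    -- The gates of `ψ` come after those of `φ` and do not overwrite their labels.
    rw [foldGates_of_notMem, ih1]
    exact fun h => disjoint_labels (by simp) (by simp)
      (gateLabel_mem_gates (p := p ++ [false]) (φ := φ) fun y => (a y).2) h
  | ex y φ ih =>
    rw [foldGates_gateLabel (GateOp.eval_congr x) _ _ _ fun y => (a y).2]
    simp only [topOp, eval, GateOp.eval, subGates, List.any_eq_true, List.mem_map, List.mem_range]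
    have e : ∀ i : Fin N.sqrt, (fun z => ((Function.update a y i z : Fin _) : ℕ)) =
        Function.update (fun z => (a z : ℕ)) y i := by
      intro i
      funext z
      by_cases h : z = y
      · subst h; simp
      · simp [h]
    constructor
    · rintro ⟨_, ⟨i, hi, rfl⟩, h⟩
      refine ⟨⟨i, hi⟩, (ih (p ++ [false]) v _).1 ?_⟩
      rw [e]; exact h
    · rintro ⟨i, h⟩
      refine ⟨_, ⟨i, i.2, rfl⟩, ?_⟩
      rw [← e]
      exact (ih (p ++ [false]) v _).2 h

theorem depths_le {N : ℕ} (p : List Bool) (φ : Formula c) (v : List Bool → ℕ) {s : List Bool}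
    (hs : s ∈ (φ.gates N p).map Gate.label) :
    foldGates (fun o v => o.depth v) (φ.gates N p) v s ≤ φ.height := by
  have key : ∀ {p : List Bool} {φ : Formula c} {v : List Bool → ℕ} {d : ℕ} {s : List Bool},
      (∀ t ∈ (φ.subGates N p).map Gate.label,
        foldGates (fun o v => o.depth v) (φ.subGates N p) v t ≤ d) →
      s ∈ (φ.gates N p).map Gate.label →
        foldGates (fun o v => o.depth v) (φ.gates N p) v s ≤ d + 1 := by
    intro p φ v d s h hs
    rw [gates_eq, List.map_append, List.mem_append] at hs
    rcases hs with hs | hs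
    · rw [foldGates_subGates _ _ _ _ hs]
      exact (h s hs).trans (Nat.le_succ d)
    · obtain ⟨a, ha, rfl⟩ := mem_labels_gateLayer.1 hs
      rw [foldGates_gateLabel GateOp.depth_congr _ _ _ ha]
      exact GateOp.depth_le _ fun t ht => h t (mem_subGates_of_mem_args ha ht)
  induction φ generalizing p v s with
  | adj x y => exact key (d := 0) (by simp [subGates]) hs
  | num q => exact key (d := 0) (by simp [subGates]) hs
  | not φ ih => exact key (fun t ht => ih _ _ ht) hs
  | and φ ψ ih1 ih2 =>
    refine key (fun t ht => ?_) hs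
    simp only [subGates, foldGates_append]
    by_cases h2 : t ∈ (ψ.gates N (p ++ [true])).map Gate.label
    · exact (ih2 _ _ h2).trans (le_max_right _ _)
    · rw [foldGates_of_notMem _ _ h2]
      simp only [subGates, List.map_append, List.mem_append] at ht
      exact (ih1 _ _ (ht.resolve_right h2)).trans (le_max_left _ _)
  | ex x φ ih => exact key (fun t ht => ih _ _ ht) hs

theorem length_gates (N : ℕ) (p : List Bool) (φ : Formula c) :
    (φ.gates N p).length = φ.nodes * N.sqrt ^ c := by
  induction φ generalizing p <;>
    simp_all [gates, nodes, gateLayer, allAssignments, length_assignments, add_mul, add_assoc]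

end Formula

/-! ### The circuit of a pair of formulas -/

/-- The circuit that writes, for all values `u` of the variable `x`, the truth value of `φ`, and then
for all values `u`, `w` of `x`, `y` and all powers of two `2 ^ b` below the number of vertices as
values of `z`, the truth value of `ψ`. -/
def queryCircuit {c : ℕ} (N : ℕ) (x y z : Fin c) (φ ψ : Formula c) : Circuit N where
  gates := φ.gates N [false] ++ ψ.gates N [true]
  outputs := (List.range N.sqrt).map (fun u => gateLabel N [false] (Function.update 0 x u)) ++
    (List.range N.sqrt).flatMap fun u => (List.range N.sqrt).flatMap fun w =>
      (List.range (Nat.clog 2 N.sqrt)).map fun b => gateLabel N [true]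
        (Function.update (Function.update (Function.update 0 x u) y w) z (2 ^ b))

theorem update_apply_lt {ι : Type} [DecidableEq ι] {m : ℕ} {a : ι → ℕ} (h : ∀ y, a y < m) {x : ι}
    {i : ℕ} (hi : i < m) (y : ι) : Function.update a x i y < m := by
  by_cases e : y = x
  · subst e; simpa using hi
  · rw [Function.update_of_ne e]; exact h y

/-- A digit position of a vertex number is represented by its power of two. The positions below
`⌈log₂ m⌉` are exactly those whose power is itself a vertex number, so a variable of a formula can
range over them. -/
theorem two_pow_lt_iff_lt_clog {b m : ℕ} : 2 ^ b < m ↔ b < Nat.clog 2 m := by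
  rw [← not_le, ← not_le, Nat.clog_le_iff_le_pow (by norm_num)]

theorem queryCircuit_wellFormed {c : ℕ} (N : ℕ) (x y z : Fin c) (φ ψ : Formula c) :
    (queryCircuit N x y z φ ψ).WellFormed := by
  refine ⟨?_, ?_, ?_⟩
  · simp only [queryCircuit, List.map_append]
    exact Formula.nodup_labels.append Formula.nodup_labels
      (Formula.disjoint_labels (by simp) (by simp))
  · intro pre g post e a ha
    have h : FedBy ∅ (queryCircuit N x y z φ ψ).gates :=
      Formula.fedBy_gates.append (Formula.fedBy_gates.mono (Set.empty_subset _))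
    rw [e] at h
    exact (h.mem_of_split ha).resolve_left (Set.notMem_empty _)
  · intro a ha
    simp only [queryCircuit, List.mem_append, List.mem_map, List.mem_flatMap, List.mem_range] at ha
    simp only [queryCircuit, List.map_append, List.mem_append]
    rcases ha with ⟨u, hu, rfl⟩ | ⟨u, hu, w, hw, b, hb, rfl⟩
    · exact Or.inl (Formula.gateLabel_mem_gates
        (update_apply_lt (fun _ => (Nat.zero_le u).trans_lt hu) hu))
    · exact Or.inr (Formula.gateLabel_mem_gates
        (update_apply_lt (update_apply_lt (update_apply_lt
          (fun _ => (Nat.zero_le u).trans_lt hu) hu) hw) (two_pow_lt_iff_lt_clog.2 hb)))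

theorem queryCircuit_depth_le {c : ℕ} (N : ℕ) (x y z : Fin c) (φ ψ : Formula c) :
    (queryCircuit N x y z φ ψ).depth ≤ max φ.height ψ.height := by
  refine foldr_max_le fun d hd => ?_
  simp only [List.mem_map] at hd
  obtain ⟨g, hg, rfl⟩ := hd
  have hg' := List.mem_map_of_mem (f := Gate.label) hg
  change foldGates (fun o v => o.depth v) (φ.gates N [false] ++ ψ.gates N [true]) _ _ ≤ _
  rw [foldGates_append]
  by_cases h2 : g.label ∈ (ψ.gates N [true]).map Gate.label
  · exact (Formula.depths_le _ _ _ h2).trans (le_max_right _ _)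
  · rw [foldGates_of_notMem _ _ h2]
    simp only [queryCircuit, List.map_append, List.mem_append] at hg'
    exact (Formula.depths_le _ _ _ (hg'.resolve_right h2)).trans (le_max_left _ _)

theorem queryCircuit_size {c : ℕ} (N : ℕ) (x y z : Fin c) (φ ψ : Formula c) :
    (queryCircuit N x y z φ ψ).size = (φ.nodes + ψ.nodes) * N.sqrt ^ c := by
  simp [Circuit.size, queryCircuit, Formula.length_gates, add_mul]

theorem queryCircuit_size_le {c : ℕ} (N : ℕ) (x y z : Fin c) (φ ψ : Formula c) {k : ℕ}
    (hk : φ.nodes + ψ.nodes + c ≤ k) : (queryCircuit N x y z φ ψ).size ≤ N ^ k + k := by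
  rw [queryCircuit_size]
  have h1 : N.sqrt ^ c ≤ N ^ c := Nat.pow_le_pow_left (Nat.sqrt_le_self N) c
  set n := φ.nodes + ψ.nodes
  -- For `N ≤ 1` the power `N ^ k` cannot absorb the number of nodes, and the additive `k` does; for
  -- `N ≥ 2` one has `n ≤ N ^ n`.
  rcases le_or_gt N 1 with h | h
  · have : N ^ c ≤ 1 := by simpa using Nat.pow_le_pow_left h c
    have : n * N.sqrt ^ c ≤ n * 1 := Nat.mul_le_mul_left _ (h1.trans this)
    omega
  · have h2 : n ≤ N ^ n := (Nat.lt_pow_self h).le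
    calc n * N.sqrt ^ c ≤ N ^ n * N ^ c := Nat.mul_le_mul h2 h1
      _ = N ^ (n + c) := (pow_add _ _ _).symm
      _ ≤ N ^ k := Nat.pow_le_pow_right (by omega) hk
      _ ≤ N ^ k + k := Nat.le_add_right _ _

theorem queryCircuit_eval {c : ℕ} (N : ℕ) {x y z : Fin c} (hxy : x ≠ y) (hxz : x ≠ z) (hyz : y ≠ z)
    (φ ψ : Formula c) (s : Fin N → Bool) (f : ℕ → Bool) (g : ℕ → ℕ → ℕ → Bool)
    (hf : ∀ a, φ.eval (inputRel s) a ↔ f (a x) = true)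
    (hg : ∀ a, ψ.eval (inputRel s) a ↔ g (a x) (a y) (a z) = true) :
    (queryCircuit N x y z φ ψ).eval s = (List.range N.sqrt).map f ++
      (List.range N.sqrt).flatMap fun u => (List.range N.sqrt).flatMap fun w =>
        (List.range (Nat.clog 2 N.sqrt)).map fun b => g u w (2 ^ b) := by
  have hφ : ∀ a : Fin c → ℕ, (∀ y, a y < N.sqrt) →
      (queryCircuit N x y z φ ψ).values s (gateLabel N [false] a) = f (a x) := by
    intro a ha
    change foldGates (fun o v => o.eval s v) (φ.gates N [false] ++ ψ.gates N [true]) _ _ = _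
    rw [foldGates_append, foldGates_of_notMem, Bool.eq_iff_iff]
    · exact (Formula.values_gateLabel s [false] φ _ fun y => ⟨a y, ha y⟩).trans (hf _)
    · exact fun h => Formula.disjoint_labels (by simp) (by simp)
        (Formula.gateLabel_mem_gates (p := [false]) (φ := φ) ha) h
  have hψ : ∀ a : Fin c → ℕ, (∀ y, a y < N.sqrt) →
      (queryCircuit N x y z φ ψ).values s (gateLabel N [true] a) = g (a x) (a y) (a z) := by
    intro a ha
    change foldGates (fun o v => o.eval s v) (φ.gates N [false] ++ ψ.gates N [true]) _ _ = _
    rw [foldGates_append, Bool.eq_iff_iff]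
    exact (Formula.values_gateLabel s [true] ψ _ fun y => ⟨a y, ha y⟩).trans (hg _)
  rw [Circuit.eval]
  change List.map _ (List.map _ _ ++ List.flatMap _ _) = _
  simp only [List.map_append, List.map_map, List.map_flatMap]
  congr 1
  · refine List.map_congr_left fun u hu => ?_
    rw [List.mem_range] at hu
    rw [Function.comp_apply,
      hφ _ (update_apply_lt (a := 0) (fun _ => (Nat.zero_le u).trans_lt hu) hu)]
    simp
  · refine List.flatMap_congr fun u hu => List.flatMap_congr fun w hw =>
      List.map_congr_left fun b hb => ?_
    rw [List.mem_range] at hu hw hb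
    rw [Function.comp_apply, hψ _ (update_apply_lt (update_apply_lt (update_apply_lt (a := 0)
          (fun _ => (Nat.zero_le u).trans_lt hu) hu) hw) (two_pow_lt_iff_lt_clog.2 hb))]
    simp [hxy, hxz, hyz]

/-! ### Paths of bounded space -/

section Paths

variable {I O : Type}

/-- The configuration `c'` is reached from `c`, and all configurations before `c'` have their heads
in the first `s` cells. -/
def Transducer.PathWithin (M : Transducer I O) (w : List I) (s : ℕ) : M.Config → M.Config → Prop :=
  Relation.ReflTransGen fun c c' => M.step w c = some c' ∧ ∀ t, c.heads t < s

/-- The machine is deterministic: every reachable configuration lies on the path to the halting one,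
so bounding the heads along this path bounds them everywhere. -/
theorem Transducer.outputsInSpace_of_pathWithin {M : Transducer I O} {w : List I} {s : ℕ}
    {c : M.Config} (h : M.PathWithin w s M.init c) (hc : M.step w c = none)
    (hs : ∀ t, c.heads t < s) : M.OutputsInSpace w c.output s := by
  refine ⟨⟨c, ?_, hc, rfl⟩, fun d hd => ?_⟩
  · exact Relation.ReflTransGen.mono (r := fun c c' => M.step w c = some c' ∧ ∀ t, c.heads t < s)
      (fun _ _ h => h.1) _ _ h
  · have key : M.PathWithin w s d c := by
      induction hd with
      | refl => exact h
      | tail _ hstep ih =>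
        rcases Relation.ReflTransGen.cases_head ih with rfl | ⟨e, he, hp⟩
        · rw [Option.mem_def] at hstep; rw [hc] at hstep; cases hstep
        · have := he.1.symm.trans hstep
          rw [Option.some.injEq] at this
          exact this ▸ hp
    rcases Relation.ReflTransGen.cases_head key with rfl | ⟨e, he, -⟩
    · exact hs
    · exact he.2

end Paths

/-! ### Machines that sweep over a word of digit vectors -/

section Sweep

variable {V O : Type}

/-- A tape symbol: blank, the left end marker, or a vector of binary digits. -/
abbrev TapeSymbol (V : Type) : Type :=
  Option (Option (V → Bool))

/-- A transducer with unary input and a single work tape. -/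
def singleTape [Finite V] (Q : Type) [Finite Q] (start : Q)
    (δ : Q → InputCell Unit → TapeSymbol V →
      Option (Q × HeadMove × TapeSymbol V × HeadMove × List O)) : Transducer Unit O where
  Q := Q
  finiteQ := inferInstance
  start := start
  K := Unit
  finiteK := inferInstance
  Γ := TapeSymbol V
  finiteΓ := inferInstance
  blank := none
  δ q i γ := (δ q i (γ ())).map fun r => (r.1, r.2.1, fun _ => (r.2.2.1, r.2.2.2.1), r.2.2.2.2)

/-- The tape with the left end marker in cell `0` and the word `l` next to it. -/
def tapeOf (l : List (V → Bool)) : ℕ → TapeSymbol V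
  | 0 => some none
  | i + 1 => (l[i]?).map some

theorem tapeOf_update (l : List (V → Bool)) (d d' : V → Bool) (l' : List (V → Bool)) :
    Function.update (tapeOf (l ++ d :: l')) (l.length + 1) (some (some d')) =
      tapeOf (l ++ d' :: l') := by
  funext i
  rcases i with _ | i
  · rw [Function.update_of_ne (by omega)]; rfl
  · by_cases h : i = l.length
    · subst h; simp [tapeOf]
    · rw [Function.update_of_ne (by omega)]
      simp only [tapeOf, List.getElem?_append]
      split_ifs with h'
      · rfl
      · obtain ⟨j, hj⟩ : ∃ j, i - l.length = j + 1 := ⟨i - l.length - 1, by omega⟩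
        rw [hj]; rfl

theorem tapeOf_update_end (l : List (V → Bool)) (d : V → Bool) :
    Function.update (tapeOf l) (l.length + 1) (some (some d)) = tapeOf (l ++ [d]) := by
  funext i
  rcases i with _ | i
  · rw [Function.update_of_ne (by omega)]; rfl
  · by_cases h : i = l.length
    · subst h; simp [tapeOf]
    · rw [Function.update_of_ne (by omega)]
      simp only [tapeOf, List.getElem?_append]
      split_ifs with h'
      · rfl
      · rw [List.getElem?_eq_none (by omega), List.getElem?_eq_none (by simp; omega)]

theorem tapeOf_at (l l' : List (V → Bool)) (d : V → Bool) :
    tapeOf (l ++ d :: l') (l.length + 1) = some (some d) := by simp [tapeOf]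

theorem tapeOf_end (l : List (V → Bool)) : tapeOf l (l.length + 1) = none := by simp [tapeOf]

theorem tapeOf_ne (l : List (V → Bool)) {i : ℕ} (h : 0 < i) : tapeOf l i ≠ some none := by
  obtain ⟨j, rfl⟩ : ∃ j, i = j + 1 := ⟨i - 1, by omega⟩
  simp only [tapeOf]
  cases l[j]? <;> simp

/-! ### Elementary paths of a machine with one work tape -/

section SingleTape

variable [Finite V] {Q : Type} [Finite Q] {start : Q} {δ : Q → InputCell Unit → TapeSymbol V →
  Option (Q × HeadMove × TapeSymbol V × HeadMove × List O)}

def tapeConfig (q : Q) (i : ℕ) (T : ℕ → TapeSymbol V) (h : ℕ) (o : List O) :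
    (singleTape Q start δ).Config :=
  ⟨q, i, fun _ => T, fun _ => h, o⟩

theorem pathWithin_step {w : List Unit} {s : ℕ} {q q' : Q} {i h : ℕ} {T : ℕ → TapeSymbol V}
    {o o' : List O} {mi mh : HeadMove} {γ : TapeSymbol V}
    (hδ : δ q (Transducer.readInput w i) (T h) = some (q', mi, γ, mh, o')) (hs : h < s) :
    (singleTape Q start δ).PathWithin w s (tapeConfig q i T h o)
      (tapeConfig q' (min (mi.apply i) (w.length + 1)) (Function.update T h γ) (mh.apply h)
        (o ++ o')) := by
  refine Relation.ReflTransGen.single ⟨?_, fun _ => hs⟩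
  simp [Transducer.step, singleTape, tapeConfig, hδ]

theorem pathWithin_back {w : List Unit} {s : ℕ} {q : Q} {i h : ℕ} {T : ℕ → TapeSymbol V}
    {o : List O} (hT : ∀ j, 0 < j → T j ≠ some none) (hi : i ≤ w.length + 1)
    (hδ : ∀ a γ, γ ≠ some none → δ q a γ = some (q, .stay, γ, .left, [])) (hs : h < s) :
    (singleTape Q start δ).PathWithin w s (tapeConfig q i T h o) (tapeConfig q i T 0 o) := by
  induction h with
  | zero => exact Relation.ReflTransGen.refl
  | succ h ih =>
    have := pathWithin_step (start := start) (o := o)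
      (hδ (Transducer.readInput w i) _ (hT (h + 1) (by omega))) hs
    simp only [HeadMove.apply, Function.update_eq_self, List.append_nil, min_eq_left hi,
      Nat.add_sub_cancel] at this
    exact this.trans (ih (by omega))

end SingleTape

/-- A left-to-right pass over the word on the tape with one bit of memory. -/
structure SweepOp (V O : Type) : Type where
  start : Bool
  digit : Bool → (V → Bool) → Bool × (V → Bool) × List O

/-- The final memory bit, the new word and the output of a pass. -/
def SweepOp.run (M : SweepOp V O) : Bool → List (V → Bool) → Bool × List (V → Bool) × List O
  | b, [] => (b, [], [])
  | b, d :: l =>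
    ((M.run (M.digit b d).1 l).1, (M.digit b d).2.1 :: (M.run (M.digit b d).1 l).2.1,
      (M.digit b d).2.2 ++ (M.run (M.digit b d).1 l).2.2)

theorem SweepOp.length_run (M : SweepOp V O) (b : Bool) (l : List (V → Bool)) :
    (M.run b l).2.1.length = l.length := by
  induction l generalizing b with
  | nil => rfl
  | cons d l ih => simp [SweepOp.run, ih]

/-- Structured programs over the word on the tape. -/
inductive Prog (V O : Type) : Type
  | emit (w : List O)
  | op (M : SweepOp V O)
  | seq (p q : Prog V O)
  | ite (M : SweepOp V O) (p q : Prog V O)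
  | loop (M : SweepOp V O) (p : Prog V O)

/-- Big-step semantics: the program turns the first word into the second and produces an output. -/
inductive Prog.Exec : Prog V O → List (V → Bool) → List (V → Bool) → List O → Prop
  | emit (w : List O) (l : List (V → Bool)) : Exec (.emit w) l l w
  | op (M : SweepOp V O) (l : List (V → Bool)) :
      Exec (.op M) l (M.run M.start l).2.1 (M.run M.start l).2.2
  | seq {p q : Prog V O} {l l' l'' : List (V → Bool)} {o o' : List O} (hp : Exec p l l' o)
      (hq : Exec q l' l'' o') : Exec (.seq p q) l l'' (o ++ o')
  | ite_true {M : SweepOp V O} {p q : Prog V O} {l l' : List (V → Bool)} {o : List O}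
      (h : (M.run M.start l).1 = true) (hp : Exec p (M.run M.start l).2.1 l' o) :
      Exec (.ite M p q) l l' ((M.run M.start l).2.2 ++ o)
  | ite_false {M : SweepOp V O} {p q : Prog V O} {l l' : List (V → Bool)} {o : List O}
      (h : (M.run M.start l).1 = false) (hq : Exec q (M.run M.start l).2.1 l' o) :
      Exec (.ite M p q) l l' ((M.run M.start l).2.2 ++ o)
  | loop_true {M : SweepOp V O} {p : Prog V O} {l l' l'' : List (V → Bool)} {o o' : List O}
      (h : (M.run M.start l).1 = true) (hp : Exec p (M.run M.start l).2.1 l' o)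
      (hl : Exec (.loop M p) l' l'' o') :
      Exec (.loop M p) l l'' ((M.run M.start l).2.2 ++ (o ++ o'))
  | loop_false {M : SweepOp V O} {p : Prog V O} {l : List (V → Bool)}
      (h : (M.run M.start l).1 = false) :
      Exec (.loop M p) l (M.run M.start l).2.1 (M.run M.start l).2.2

/-- `scan` moves right and updates the memory bit; `back` carries the final bit home to the left end
marker, where control branches on it. -/
inductive SweepState : Type
  | scan (b : Bool)
  | back (b : Bool)

instance : Finite SweepState :=
  Finite.of_injective (β := Bool × Bool)
    (fun | .scan b => (true, b) | .back b => (false, b)) (by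
      rintro (b | b) (b' | b') h <;> simp_all)

/-- One step of a pass, with states embedded into `Q` by `e` and continued in the states `k`. -/
def SweepOp.trans {Q : Type} (M : SweepOp V O) (e : SweepState → Q) (k : Bool → Q) :
    SweepState → TapeSymbol V → Q × TapeSymbol V × HeadMove × List O
  | .scan b, some none => (e (.scan b), some none, .right, [])
  | .scan b, some (some d) =>
    (e (.scan (M.digit b d).1), some (some (M.digit b d).2.1), .right, (M.digit b d).2.2)
  | .scan b, none => (e (.back b), none, .left, [])
  | .back b, some none => (k b, some none, .stay, [])
  | .back b, γ => (e (.back b), γ, .left, [])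

namespace Prog

/-- The control states of a program. -/
def State : Prog V O → Type
  | emit _ => Unit
  | op _ => SweepState
  | seq p q => p.State ⊕ q.State
  | ite _ p q => SweepState ⊕ (p.State ⊕ q.State)
  | loop _ p => SweepState ⊕ p.State

theorem finite_state (p : Prog V O) : Finite p.State := by
  induction p with
  | emit w => exact inferInstanceAs (Finite Unit)
  | op M => exact inferInstanceAs (Finite SweepState)
  | seq p q ihp ihq => exact inferInstanceAs (Finite (p.State ⊕ q.State))
  | ite M p q ihp ihq => exact inferInstanceAs (Finite (SweepState ⊕ (p.State ⊕ q.State)))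
  | loop M p ihp => exact inferInstanceAs (Finite (SweepState ⊕ p.State))

def first : (p : Prog V O) → p.State
  | emit _ => ()
  | op M => .scan M.start
  | seq p _ => .inl p.first
  | ite M _ _ => .inl (.scan M.start)
  | loop M _ => .inl (.scan M.start)

/-- One step of a program, with control states embedded into `Q` by `e` and continued in `k`. -/
def trans {Q : Type} : (p : Prog V O) → (e : p.State → Q) → (k : Q) → p.State → TapeSymbol V →
    Q × TapeSymbol V × HeadMove × List O
  | emit w, _, k, _, γ => (k, γ, .stay, w)
  | op M, e, k, s, γ => M.trans e (fun _ => k) s γ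
  | seq p q, e, _, .inl s, γ => p.trans (fun t => e (.inl t)) (e (.inr q.first)) s γ
  | seq _ q, e, k, .inr s, γ => q.trans (fun t => e (.inr t)) k s γ
  | ite M p q, e, _, .inl s, γ => M.trans (fun t => e (.inl t))
      (fun b => if b then e (.inr (.inl p.first)) else e (.inr (.inr q.first))) s γ
  | ite _ p _, e, k, .inr (.inl s), γ => p.trans (fun t => e (.inr (.inl t))) k s γ
  | ite _ _ q, e, k, .inr (.inr s), γ => q.trans (fun t => e (.inr (.inr t))) k s γ
  | loop M p, e, k, .inl s, γ => M.trans (fun t => e (.inl t))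
      (fun b => if b then e (.inr p.first) else k) s γ
  | loop M p, e, _, .inr s, γ =>
    p.trans (fun t => e (.inr t)) (e (.inl (.scan M.start))) s γ

end Prog

/-- This is the source of the space bound: the tape word keeps its length however long the program
runs. -/
theorem Prog.Exec.length_eq {p : Prog V O} {l l' : List (V → Bool)} {o : List O}
    (h : p.Exec l l' o) : l'.length = l.length := by
  induction h <;> simp_all [SweepOp.length_run]

/-! ### Simulation of programs by the machine -/

section Simulation

variable [Finite V] {Q : Type} [Finite Q] {start : Q} {δ : Q → InputCell Unit → TapeSymbol V →
  Option (Q × HeadMove × TapeSymbol V × HeadMove × List O)}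

/-- The word `l` is the part that has been passed and rewritten, `l'` the part ahead of the head;
the induction moves one digit vector from `l'` to `l`. -/
theorem pathWithin_scan {w : List Unit} {s : ℕ} (M : SweepOp V O) {e : SweepState → Q}
    {k : Bool → Q} (hδ : ∀ t a γ, δ (e t) a γ =
      some ((M.trans e k t γ).1, .stay, (M.trans e k t γ).2)) {i : ℕ} (hi : i ≤ w.length + 1)
    (l l' : List (V → Bool)) (b : Bool) (o : List O) (hs : l.length + l'.length + 1 < s) :
    (singleTape Q start δ).PathWithin w s
      (tapeConfig (e (.scan b)) i (tapeOf (l ++ l')) (l.length + 1) o)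
      (tapeConfig (e (.back (M.run b l').1)) i (tapeOf (l ++ (M.run b l').2.1))
        (l.length + l'.length) (o ++ (M.run b l').2.2)) := by
  induction l' generalizing l b o with
  | nil =>
    have := pathWithin_step (start := start) (o := o) (hδ (.scan b) (Transducer.readInput w i)
      (tapeOf l (l.length + 1))) (by simpa using hs)
    rw [tapeOf_end] at this
    simp only [SweepOp.trans, HeadMove.apply, min_eq_left hi, Nat.add_sub_cancel] at this
    rw [Function.update_eq_self_iff.2 (tapeOf_end l).symm] at this
    simpa [SweepOp.run] using this
  | cons d l' ih =>
    have := pathWithin_step (start := start) (o := o) (hδ (.scan b) (Transducer.readInput w i)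
      (tapeOf (l ++ d :: l') (l.length + 1))) (by simp at hs; omega : l.length + 1 < s)
    rw [tapeOf_at] at this
    simp only [SweepOp.trans, HeadMove.apply, min_eq_left hi] at this
    rw [tapeOf_update] at this
    refine this.trans ?_
    have h2 := ih (l ++ [(M.digit b d).2.1]) (M.digit b d).1 (o ++ (M.digit b d).2.2)
      (by simp at hs ⊢; omega)
    simp only [List.append_assoc, List.length_append, List.length_singleton,
      List.singleton_append] at h2
    simp only [SweepOp.run, List.length_cons]
    rw [show l.length + (l'.length + 1) = l.length + 1 + l'.length by omega]
    exact h2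

theorem pathWithin_sweep {w : List Unit} {s : ℕ} (M : SweepOp V O) {e : SweepState → Q}
    {k : Bool → Q} (hδ : ∀ t a γ, δ (e t) a γ =
      some ((M.trans e k t γ).1, .stay, (M.trans e k t γ).2)) {i : ℕ} (hi : i ≤ w.length + 1)
    (l : List (V → Bool)) (o : List O) (hs : l.length + 1 < s) :
    (singleTape Q start δ).PathWithin w s
      (tapeConfig (e (.scan M.start)) i (tapeOf l) 0 o)
      (tapeConfig (k (M.run M.start l).1) i (tapeOf (M.run M.start l).2.1) 0
        (o ++ (M.run M.start l).2.2)) := by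
  have h1 := pathWithin_step (start := start) (o := o) (hδ (.scan M.start)
    (Transducer.readInput w i) (tapeOf l 0)) (by omega : 0 < s)
  rw [show tapeOf l 0 = some none from rfl] at h1
  simp only [SweepOp.trans, HeadMove.apply, min_eq_left hi, List.append_nil] at h1
  rw [Function.update_eq_self_iff.2 (show some none = tapeOf l 0 from rfl)] at h1
  have h2 := pathWithin_scan (start := start) M hδ hi [] l M.start o (by simpa using hs)
  simp only [List.nil_append, List.length_nil, Nat.zero_add] at h1 h2
  set l' := (M.run M.start l).2.1
  set o' := (M.run M.start l).2.2
  set b := (M.run M.start l).1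
  have h3 := pathWithin_back (start := start) (δ := δ) (o := o ++ o') (w := w) (s := s)
    (h := l.length)
    (T := tapeOf l') (q := e (.back b)) (fun j hj => tapeOf_ne l' hj) hi (fun a γ hγ => by
      rw [hδ]
      match γ, hγ with
      | none, _ => rfl
      | some (some d), _ => rfl) (by omega)
  have h4 := pathWithin_step (start := start) (o := o ++ o') (hδ (.back b)
    (Transducer.readInput w i) (tapeOf l' 0)) (by omega : 0 < s)
  rw [show tapeOf l' 0 = some none from rfl] at h4
  simp only [SweepOp.trans, HeadMove.apply, min_eq_left hi, List.append_nil] at h4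
  rw [Function.update_eq_self_iff.2 (show some none = tapeOf l' 0 from rfl)] at h4
  exact ((h1.trans h2).trans h3).trans h4

/-- The embedding `e` of control states and the continuation `k` vary, so that a subprogram is
simulated inside the state space of the whole machine. The induction runs over the execution, since
a loop may repeat its body any number of times. -/
theorem Prog.Exec.pathWithin {p : Prog V O} {l l' : List (V → Bool)} {o : List O}
    (h : p.Exec l l' o) {w : List Unit} {s : ℕ} {e : p.State → Q} {k : Q}
    (hδ : ∀ t a γ, δ (e t) a γ = some ((p.trans e k t γ).1, .stay, (p.trans e k t γ).2)) {i : ℕ}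
    (hi : i ≤ w.length + 1) (o' : List O) (hs : l.length + 1 < s) :
    (singleTape Q start δ).PathWithin w s (tapeConfig (e p.first) i (tapeOf l) 0 o')
      (tapeConfig k i (tapeOf l') 0 (o' ++ o)) := by
  induction h generalizing k o' with
  | emit u l =>
    have h1 := pathWithin_step (start := start) (o := o') (hδ ()
      (Transducer.readInput w i) (tapeOf l 0)) (by omega : 0 < s)
    simp only [Prog.trans, HeadMove.apply, min_eq_left hi, Function.update_eq_self] at h1
    exact h1
  | op M l => exact pathWithin_sweep M (k := fun _ => k) hδ hi l o' hs
  | seq hp hq ihp ihq =>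
    rw [← List.append_assoc]
    exact (ihp (e := fun t => e (.inl t)) (fun t => hδ (.inl t)) o' hs).trans
      (ihq (e := fun t => e (.inr t)) (fun t => hδ (.inr t)) _ (by rwa [hp.length_eq]))
  | @ite_true M p q l l' o hb hp ih =>
    rw [← List.append_assoc]
    have h1 := pathWithin_sweep (start := start) M (e := fun t => e (.inl t))
      (fun t => hδ (.inl t)) hi l o' hs
    rw [hb] at h1
    exact h1.trans (ih (e := fun t => e (.inr (.inl t))) (fun t => hδ (.inr (.inl t))) _
      (by rwa [SweepOp.length_run]))
  | @ite_false M p q l l' o hb hp ih =>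
    rw [← List.append_assoc]
    have h1 := pathWithin_sweep (start := start) M (e := fun t => e (.inl t))
      (fun t => hδ (.inl t)) hi l o' hs
    rw [hb] at h1
    exact h1.trans (ih (e := fun t => e (.inr (.inr t))) (fun t => hδ (.inr (.inr t))) _
      (by rwa [SweepOp.length_run]))
  | @loop_true M p l l' l'' o o₂ hb hp hl ihp ihl =>
    rw [← List.append_assoc, ← List.append_assoc]
    have h1 := pathWithin_sweep (start := start) M (e := fun t => e (.inl t))
      (fun t => hδ (.inl t)) hi l o' hs
    rw [hb] at h1
    exact (h1.trans (ihp (e := fun t => e (.inr t)) (fun t => hδ (.inr t)) _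
      (by rwa [SweepOp.length_run]))).trans
        (ihl hδ _ (by rwa [hp.length_eq, SweepOp.length_run]))
  | @loop_false M p l hb =>
    have h1 := pathWithin_sweep (start := start) M (e := fun t => e (.inl t))
      (fun t => hδ (.inl t)) hi l o' hs
    rw [hb] at h1
    exact h1

end Simulation

/-! ### The machine of a program -/

/-- The input head acts as the clock of a binary counter. Each input cell seen in `ready` starts an
increment (`carry`), after which `back` returns to the marker and the input head advances. At the
right end, `pad` appends three zeros and `padBack` leads into the program. -/
inductive SetupState : Type
  | begin
  | ready
  | carry
  | back
  | pad (k : Fin 4)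
  | padBack

instance : Finite SetupState :=
  Finite.of_injective (β := Fin 6 × Fin 4)
    (fun
      | .begin => (0, 0)
      | .ready => (1, 0)
      | .carry => (2, 0)
      | .back => (3, 0)
      | .pad k => (4, k)
      | .padBack => (5, 0)) (by
      rintro (_ | _ | _ | _ | _ | _) (_ | _ | _ | _ | _ | _) h <;> simp_all)

/-- The digit vector with `b` in the component `r` and `0` elsewhere. -/
def singleDigit [DecidableEq V] (r : V) (b : Bool) : V → Bool :=
  Function.update (fun _ => false) r b

/-- The machine first writes its input length in binary into the component `r`, with three leading
zeros, and then runs the program `p`. -/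
def machineTrans [DecidableEq V] (r : V) (p : Prog V O) :
    SetupState ⊕ (p.State ⊕ Unit) → InputCell Unit → TapeSymbol V →
      Option ((SetupState ⊕ (p.State ⊕ Unit)) × HeadMove × TapeSymbol V × HeadMove × List O)
  | .inl .begin, _, _ => some (.inl .ready, .right, some none, .stay, [])
  | .inl .ready, .symbol _, γ => some (.inl .carry, .stay, γ, .right, [])
  | .inl .ready, _, γ => some (.inl (.pad 3), .stay, γ, .right, [])
  | .inl .carry, _, some (some d) =>
    if d r then some (.inl .carry, .stay, some (some (Function.update d r false)), .right, [])
    else some (.inl .back, .stay, some (some (Function.update d r true)), .stay, [])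
  | .inl .carry, _, _ => some (.inl .back, .stay, some (some (singleDigit r true)), .stay, [])
  | .inl .back, _, some none => some (.inl .ready, .right, some none, .stay, [])
  | .inl .back, _, γ => some (.inl .back, .stay, γ, .left, [])
  | .inl (.pad k), _, none =>
    if k = 0 then some (.inl .padBack, .stay, none, .left, [])
    else some (.inl (.pad (k - 1)), .stay, some (some fun _ => false), .right, [])
  | .inl (.pad k), _, γ => some (.inl (.pad k), .stay, γ, .right, [])
  | .inl .padBack, _, some none => some (.inr (.inl p.first), .stay, some none, .stay, [])
  | .inl .padBack, _, γ => some (.inl .padBack, .stay, γ, .left, [])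
  | .inr (.inl s), _, γ => some ((p.trans (fun t => .inr (.inl t)) (.inr (.inr ())) s γ).1, .stay,
      (p.trans (Q := SetupState ⊕ (p.State ⊕ Unit)) (fun t => .inr (.inl t)) (.inr (.inr ())) s γ).2)
  | .inr (.inr _), _, _ => none

section Machine

variable [Finite V] [DecidableEq V] (r : V) (p : Prog V O)

instance : Finite (SetupState ⊕ (p.State ⊕ Unit)) :=
  have := p.finite_state
  inferInstance

def progMachine : Transducer Unit O :=
  singleTape (SetupState ⊕ (p.State ⊕ Unit)) (.inl .begin) (machineTrans r p)

variable {r p}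

/-- Binary increment, by induction on halving `k`: a lowest digit `1` is cleared and the carry goes
on to `k / 2`, a lowest digit `0` or a blank becomes `1` and ends it. Only a bound on the final head
position is kept, because the head is brought home afterwards. -/
theorem pathWithin_carry {w : List Unit} {s i : ℕ} (hi : i ≤ w.length + 1) (k : ℕ)
    (l : List (V → Bool)) (o : List O) (hs : l.length + k.bits.length + 1 < s) :
    ∃ h < s, (progMachine r p).PathWithin w s
      (tapeConfig (.inl .carry) i (tapeOf (l ++ k.bits.map (singleDigit r))) (l.length + 1) o)
      (tapeConfig (.inl .back) i (tapeOf (l ++ (k + 1).bits.map (singleDigit r))) h o) := by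
  have step : ∀ (T : ℕ → TapeSymbol V) (h : ℕ) {q' γ mh}, machineTrans r p (.inl .carry)
      (Transducer.readInput w i) (T h) = some (q', .stay, γ, mh, []) → h < s →
      (progMachine r p).PathWithin w s (tapeConfig (.inl .carry) i T h o)
        (tapeConfig q' i (Function.update T h γ) (mh.apply h) o) := by
    intro T h q' γ mh hδ hh
    have := pathWithin_step (start := .inl .begin) (o := o) hδ hh
    rw [show HeadMove.stay.apply i = i from rfl, min_eq_left hi, List.append_nil] at this
    exact this
  have hupd : ∀ b b' : Bool, Function.update (singleDigit r b) r b' = singleDigit r b' := by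
    intro b b'; simp [singleDigit]
  induction k using Nat.strong_induction_on generalizing l with
  | _ k ih =>
    rcases Nat.even_or_odd' k with ⟨j, rfl | rfl⟩
    · by_cases hj : j = 0
      · subst hj
        refine ⟨l.length + 1, by omega, ?_⟩
        have := step (tapeOf l) (l.length + 1) (q' := .inl .back)
          (γ := some (some (singleDigit r true))) (mh := .stay) (by rw [tapeOf_end]; rfl) (by omega)
        rw [tapeOf_update_end] at this
        simpa [HeadMove.apply] using this
      · rw [Nat.bit0_bits j hj] at hs ⊢
        rw [Nat.bit1_bits]
        refine ⟨l.length + 1, by omega, ?_⟩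
        have := step (tapeOf (l ++ (false :: j.bits).map (singleDigit r))) (l.length + 1)
          (q' := .inl .back) (γ := some (some (singleDigit r true))) (mh := .stay)
          (by
            rw [List.map_cons, tapeOf_at, ← hupd false true]
            simp [machineTrans, singleDigit]) (by omega)
        rw [List.map_cons, tapeOf_update] at this
        exact this
    · rw [Nat.bit1_bits] at hs ⊢
      rw [show 2 * j + 1 + 1 = 2 * (j + 1) by ring, Nat.bit0_bits _ (by omega)]
      have := step (tapeOf (l ++ (true :: j.bits).map (singleDigit r))) (l.length + 1)
          (q' := .inl .carry) (γ := some (some (singleDigit r false))) (mh := .right)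
          (by
            rw [List.map_cons, tapeOf_at, ← hupd true false]
            simp [machineTrans, singleDigit]) (by simp at hs; omega)
      rw [List.map_cons, tapeOf_update] at this
      obtain ⟨h, hh, hp⟩ := ih j (by omega) (l ++ [singleDigit r false]) (by simp at hs ⊢; omega)
      refine ⟨h, hh, ?_⟩
      simp only [List.append_assoc, List.singleton_append, List.length_append,
        List.length_singleton] at hp
      exact this.trans hp

theorem pathWithin_count {w : List Unit} {s k : ℕ} (hk : k < w.length) (o : List O)
    (hs : k.bits.length + 1 < s) :
    (progMachine r p).PathWithin w s
      (tapeConfig (.inl .ready) (k + 1) (tapeOf (k.bits.map (singleDigit r))) 0 o)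
      (tapeConfig (.inl .ready) (k + 1 + 1) (tapeOf ((k + 1).bits.map (singleDigit r))) 0 o) := by
  have hi : k + 1 ≤ w.length + 1 := by omega
  have h1 := pathWithin_step (start := .inl .begin) (δ := machineTrans r p) (w := w) (s := s)
    (i := k + 1) (T := tapeOf (k.bits.map (singleDigit r))) (h := 0) (q := .inl .ready)
    (q' := .inl .carry) (mi := .stay) (mh := .right) (γ := some none) (o' := []) (o := o)
    (by
      have : Transducer.readInput w (k + 1) = .symbol () := by
        simp [Transducer.readInput, List.getElem?_eq_getElem hk]
      rw [this]; rfl) (by omega)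
  simp only [HeadMove.apply, min_eq_left hi, List.append_nil] at h1
  rw [Function.update_eq_self_iff.2 (show some none = tapeOf _ 0 from rfl)] at h1
  obtain ⟨h, hh, h2⟩ := pathWithin_carry (r := r) (p := p) (s := s) hi k [] o (by simpa using hs)
  simp only [List.nil_append, List.length_nil] at h2
  have h3 := pathWithin_back (start := .inl .begin) (δ := machineTrans r p) (w := w) (s := s)
    (o := o) (T := tapeOf ((k + 1).bits.map (singleDigit r))) (q := .inl .back)
    (fun j hj => tapeOf_ne _ hj) hi (fun a γ hγ => by
      match γ, hγ with
      | none, _ => rfl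
      | some (some d), _ => rfl) hh
  have h4 := pathWithin_step (start := .inl .begin) (δ := machineTrans r p) (w := w) (s := s)
    (i := k + 1) (T := tapeOf ((k + 1).bits.map (singleDigit r))) (h := 0) (q := .inl .back)
    (q' := .inl .ready) (mi := .right) (mh := .stay) (γ := some none) (o' := []) (o := o)
    rfl (by omega)
  simp only [HeadMove.apply, List.append_nil] at h4
  rw [Function.update_eq_self_iff.2 (show some none = tapeOf _ 0 from rfl),
    min_eq_left (by omega : k + 1 + 1 ≤ w.length + 1)] at h4
  exact ((h1.trans h2).trans h3).trans h4

theorem pathWithin_countAll {w : List Unit} {s k : ℕ} (hk : k ≤ w.length) (o : List O)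
    (hs : w.length.bits.length + 1 < s) :
    (progMachine r p).PathWithin w s
      (tapeConfig (.inl .ready) 1 (tapeOf []) 0 o)
      (tapeConfig (.inl .ready) (k + 1) (tapeOf (k.bits.map (singleDigit r))) 0 o) := by
  induction k with
  | zero => exact Relation.ReflTransGen.refl
  | succ k ih =>
    refine (ih (by omega)).trans (pathWithin_count (by omega) o ?_)
    have : k.size ≤ w.length.size := Nat.size_le_size (by omega)
    rw [Nat.size_eq_bits_len] at hs ⊢
    omega

theorem pathWithin_padScan {w : List Unit} {s i : ℕ} (hi : i ≤ w.length + 1)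
    (l l' : List (V → Bool)) (k : Fin 4) (o : List O) (hs : l.length + l'.length + 1 < s) :
    (progMachine r p).PathWithin w s
      (tapeConfig (.inl (.pad k)) i (tapeOf (l ++ l')) (l.length + 1) o)
      (tapeConfig (.inl (.pad k)) i (tapeOf (l ++ l')) (l.length + l'.length + 1) o) := by
  induction l' generalizing l with
  | nil => exact Relation.ReflTransGen.refl
  | cons d l' ih =>
    have h1 := pathWithin_step (start := .inl .begin) (δ := machineTrans r p) (w := w) (s := s)
      (i := i) (T := tapeOf (l ++ d :: l')) (h := l.length + 1) (q := .inl (.pad k))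
      (q' := .inl (.pad k)) (mi := .stay) (mh := .right) (γ := some (some d)) (o' := []) (o := o)
      (by rw [tapeOf_at]; rfl) (by simp at hs; omega)
    rw [tapeOf_update] at h1
    simp only [HeadMove.apply, min_eq_left hi, List.append_nil] at h1
    have h2 := ih (l ++ [d]) (by simp at hs ⊢; omega)
    simp only [List.append_assoc, List.singleton_append, List.length_append,
        List.length_singleton] at h2
    rw [List.length_cons, show l.length + (l'.length + 1) + 1 = l.length + 1 + l'.length + 1 by ring]
    exact h1.trans h2

theorem pathWithin_pad {w : List Unit} {s i : ℕ} (hi : i ≤ w.length + 1) (k : ℕ) (hk : k < 4)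
    (l : List (V → Bool)) (o : List O) (hs : l.length + k + 1 < s) :
    (progMachine r p).PathWithin w s
      (tapeConfig (.inl (.pad ⟨k, hk⟩)) i (tapeOf l) (l.length + 1) o)
      (tapeConfig (.inr (.inl p.first)) i (tapeOf (l ++ List.replicate k fun _ => false)) 0 o) := by
  induction k generalizing l with
  | zero =>
    have h1 := pathWithin_step (start := .inl .begin) (δ := machineTrans r p) (w := w) (s := s)
      (i := i) (T := tapeOf l) (h := l.length + 1) (q := .inl (.pad ⟨0, hk⟩))
      (q' := .inl .padBack) (mi := .stay) (mh := .left) (γ := none) (o' := []) (o := o)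
      (by rw [tapeOf_end]; rfl) (by omega)
    simp only [HeadMove.apply, min_eq_left hi, List.append_nil] at h1
    rw [Function.update_eq_self_iff.2 (tapeOf_end l).symm] at h1
    have h3 := pathWithin_back (start := .inl .begin) (δ := machineTrans r p) (w := w) (s := s)
      (o := o) (T := tapeOf l) (q := .inl .padBack) (h := l.length + 1 - 1)
      (fun j hj => tapeOf_ne _ hj) hi (fun a γ hγ => by
        match γ, hγ with
        | none, _ => rfl
        | some (some d), _ => rfl) (by omega)
    have h4 := pathWithin_step (start := .inl .begin) (δ := machineTrans r p) (w := w) (s := s)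
      (i := i) (T := tapeOf l) (h := 0) (q := .inl .padBack)
      (q' := .inr (.inl p.first)) (mi := .stay) (mh := .stay) (γ := some none) (o' := []) (o := o)
      rfl (by omega)
    simp only [HeadMove.apply, min_eq_left hi, List.append_nil] at h4
    rw [Function.update_eq_self_iff.2 (show some none = tapeOf _ 0 from rfl)] at h4
    rw [List.replicate_zero, List.append_nil]
    exact (h1.trans h3).trans h4
  | succ k ih =>
    have h1 := pathWithin_step (start := .inl .begin) (δ := machineTrans r p) (w := w) (s := s)
      (i := i) (T := tapeOf l) (h := l.length + 1) (q := .inl (.pad ⟨k + 1, hk⟩))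
      (q' := .inl (.pad ⟨k, by omega⟩)) (mi := .stay) (mh := .right)
      (γ := some (some fun _ => false)) (o' := []) (o := o)
      (by
        rw [tapeOf_end]
        have : (⟨k + 1, hk⟩ : Fin 4) ≠ 0 := by simp [Fin.ext_iff]
        have h2 : (⟨k + 1, hk⟩ : Fin 4) - 1 = ⟨k, by omega⟩ := by
          have hk' : k < 3 := by omega
          interval_cases k <;> rfl
        simp [machineTrans, h2]) (by omega)
    rw [tapeOf_update_end] at h1
    simp only [HeadMove.apply, min_eq_left hi, List.append_nil] at h1
    have h2 := ih (by omega) (l ++ [fun _ => false]) (by simp; omega)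
    simp only [List.append_assoc, List.singleton_append, List.length_append,
        List.length_singleton] at h2
    exact h1.trans h2

/-- The word on the tape of the machine when the program starts. -/
def startWord (r : V) (N : ℕ) : List (V → Bool) :=
  N.bits.map (singleDigit r) ++ List.replicate 3 fun _ => false

theorem progMachine_outputsInSpace {N : ℕ} {l : List (V → Bool)} {o : List O}
    (h : p.Exec (startWord r N) l o) :
    (progMachine r p).OutputsInSpace (List.replicate N ()) o (6 * (Nat.log 2 N + 1)) := by
  set w := List.replicate N ()
  have hw : w.length = N := by simp [w]
  set s := 6 * (Nat.log 2 N + 1)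
  have hN : N.bits.length ≤ Nat.log 2 N + 1 := by
    rw [Nat.size_eq_bits_len, Nat.size_le]
    exact Nat.lt_pow_succ_log_self (by norm_num) N
  -- At most `Nat.log 2 N + 1` digits, three padding zeros and the end marker; the factor `6` covers
  -- them even for `Nat.log 2 N = 0`.
  have hs : N.bits.length + 3 + 1 < s := by omega
  have h0 := pathWithin_step (start := .inl .begin) (δ := machineTrans r p) (w := w) (s := s)
      (i := 0) (T := fun _ => none) (h := 0) (q := .inl .begin) (q' := .inl .ready) (mi := .right)
      (mh := .stay) (γ := some none) (o' := []) (o := []) rfl (by omega)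
  have hT : Function.update (fun _ : ℕ => none) 0 (some none) = tapeOf ([] : List (V → Bool)) := by
    funext i
    rcases i with _ | i
    · rfl
    · rw [Function.update_of_ne (by omega)]; simp [tapeOf]
  rw [hT] at h0
  simp only [HeadMove.apply, List.append_nil] at h0
  rw [min_eq_left (by omega)] at h0
  have h1 := pathWithin_countAll (r := r) (p := p) (w := w) (s := s) (k := N) hw.ge ([] : List O)
    (by rw [hw]; omega)
  have h2 := pathWithin_step (start := .inl .begin) (δ := machineTrans r p) (w := w) (s := s)
    (i := N + 1) (T := tapeOf (N.bits.map (singleDigit r))) (h := 0) (q := .inl .ready)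
    (q' := .inl (.pad 3)) (mi := .stay) (mh := .right) (γ := some none) (o' := []) (o := [])
    (by
      have : Transducer.readInput w (N + 1) = .rightEnd := by
        simp [Transducer.readInput, List.getElem?_eq_none hw.le]
      rw [this]; rfl) (by omega)
  simp only [HeadMove.apply, List.append_nil] at h2
  rw [Function.update_eq_self_iff.2 (show some none = tapeOf _ 0 from rfl),
    min_eq_left (by omega)] at h2
  have h3 := pathWithin_padScan (r := r) (p := p) (w := w) (s := s) (i := N + 1) (by omega) []
    (N.bits.map (singleDigit r)) 3 ([] : List O) (by simp; omega)
  simp only [List.nil_append, List.length_nil, Nat.zero_add] at h3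
  have h4 := pathWithin_pad (r := r) (p := p) (w := w) (s := s) (i := N + 1) (by omega) 3 (by omega)
    (N.bits.map (singleDigit r)) ([] : List O) (by simp; omega)
  have h5 := h.pathWithin (start := .inl .begin) (δ := machineTrans r p) (w := w) (s := s)
    (e := fun t => .inr (.inl t)) (k := .inr (.inr ())) (fun t a γ => rfl) (i := N + 1) (by omega)
    [] (by simp [startWord]; omega)
  have h6 := ((((h0.trans h1).trans h2).trans h3).trans h4).trans h5
  exact Transducer.outputsInSpace_of_pathWithin (M := progMachine r p) h6 rfl
    (fun _ => show 0 < s by omega)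

end Machine

end Sweep

/-! ### Arithmetic by passes over binary numbers -/

section Arithmetic

variable {V O : Type} [DecidableEq V]

theorem digitVecs_succ_update (W : ℕ) (v : V → ℕ) (x : V) (k : ℕ) :
    digitVecs (W + 1) (Function.update v x k) =
      Function.update (fun y => decide (v y % 2 = 1)) x (decide (k % 2 = 1)) ::
        digitVecs W (Function.update (fun y => v y / 2) x (k / 2)) := by
  rw [digitVecs]
  congr 2 <;> funext y <;> by_cases h : y = x <;> simp [h]

/-- Joins the setup phase to the register semantics: the program starts with `N` in the register `r`
and `0` in all others. -/
theorem startWord_eq (r : V) (N : ℕ) :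
    startWord r N = digitVecs (labelWidth N) (Function.update 0 r N) := by
  have zero : ∀ k : ℕ, List.replicate k (fun _ => false) = digitVecs k (0 : V → ℕ) := by
    intro k
    induction k with
    | zero => rfl
    | succ k ih =>
      rw [List.replicate_succ, ih, digitVecs]
      simp
      rfl
  rw [startWord, labelWidth]
  induction N using Nat.strong_induction_on with
  | _ N ih =>
    rcases Nat.even_or_odd' N with ⟨j, rfl | rfl⟩
    · by_cases hj : j = 0
      · subst hj
        simp only [mul_zero, Nat.zero_bits, List.map_nil, List.nil_append, Nat.size_zero, zero_add]
        rw [zero]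
        simp
      · have hs : (2 * j).size = j.size + 1 := by
          rw [← Nat.size_eq_bits_len, ← Nat.size_eq_bits_len, Nat.bit0_bits j hj]; simp
        rw [Nat.bit0_bits j hj, hs, show j.size + 1 + 3 = j.size + 3 + 1 by ring,
          digitVecs_succ_update, List.map_cons, List.cons_append, ih j (by omega)]
        congr 1
        · funext y; simp [singleDigit]
        · rw [show 2 * j / 2 = j by omega]
          congr 2
          funext y
          simp
    · have hs : (2 * j + 1).size = j.size + 1 := by
        rw [← Nat.size_eq_bits_len, ← Nat.size_eq_bits_len, Nat.bit1_bits j]; simp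
      rw [Nat.bit1_bits j, hs, show j.size + 1 + 3 = j.size + 3 + 1 by ring,
        digitVecs_succ_update, List.map_cons, List.cons_append, ih j (by omega)]
      congr 1
      · funext y; simp [singleDigit]
      · rw [show (2 * j + 1) / 2 = j by omega]
        congr 2
        funext y
        simp

namespace SweepOp

def zero (x : V) : SweepOp V O := ⟨false, fun b d => (b, Function.update d x false, [])⟩

def copy (x y : V) : SweepOp V O := ⟨false, fun b d => (b, Function.update d x (d y), [])⟩

def inc (x : V) : SweepOp V O :=
  ⟨true, fun b d => (b && d x, Function.update d x (xor b (d x)), [])⟩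

def add (x y : V) : SweepOp V O :=
  ⟨false, fun b d => ((b && d x) || (b && d y) || (d x && d y),
    Function.update d x (xor b (xor (d x) (d y))), [])⟩

/-- The test `x < y` if `b` is `false`, and `x ≤ y` if `b` is `true`. -/
def compare (b : Bool) (x y : V) : SweepOp V O :=
  ⟨b, fun b d => (if d x = d y then b else d y, d, [])⟩

def equal (x y : V) : SweepOp V O := ⟨true, fun b d => (b && d x == d y, d, [])⟩

/-- Do the numbers `x` and `y` have a common binary digit `1`? -/
def meet (x y : V) : SweepOp V O := ⟨false, fun b d => (b || (d x && d y), d, [])⟩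

/-- Writes the digits of `x` at the positions of the digits `1` of `y`. -/
def emitAt (f : Bool → O) (x y : V) : SweepOp V O :=
  ⟨false, fun b d => (b, d, if d y then [f (d x)] else [])⟩

def emitAll (f : (V → Bool) → List O) : SweepOp V O := ⟨false, fun b d => (b, d, f d)⟩

theorem run_zero (W : ℕ) (x : V) (b : Bool) (v : V → ℕ) :
    (zero x : SweepOp V O).run b (digitVecs W v) =
      (b, digitVecs W (Function.update v x 0), []) := by
  induction W generalizing v with
  | zero => rfl
  | succ W ih =>
    rw [digitVecs_succ_update]
    have := ih fun x => v x / 2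
    simp only [run, digitVecs] at *
    simp [zero] at *
    simp [this]

theorem run_copy (W : ℕ) (x y : V) (b : Bool) (v : V → ℕ) :
    (copy x y : SweepOp V O).run b (digitVecs W v) =
      (b, digitVecs W (Function.update v x (v y)), []) := by
  induction W generalizing v with
  | zero => rfl
  | succ W ih =>
    rw [digitVecs_succ_update]
    have := ih fun x => v x / 2
    simp only [run, digitVecs] at *
    simp [copy] at *
    simp [this]

/-- The final memory bit is the overflow and is left unspecified. Since `digitVecs` drops higher
digits, both sides agree modulo `2 ^ W`, and no bound on `v` is required. -/
theorem run_inc (W : ℕ) (x : V) (b : Bool) (v : V → ℕ) :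
    ((inc x : SweepOp V O).run b (digitVecs W v)).2 =
      (digitVecs W (Function.update v x (v x + b.toNat)), []) := by
  induction W generalizing v b with
  | zero => rfl
  | succ W ih =>
    rw [digitVecs_succ_update]
    simp only [run, digitVecs]
    rw [ih]
    have e : (v x + 1) / 2 = v x / 2 + v x % 2 := by omega
    rcases Nat.mod_two_eq_zero_or_one (v x) with h | h <;> cases b <;>
      simp [inc, h, e, Nat.add_mod]

/-- The memory bit is the carry. The case `x = y` is included and doubles the register. -/
theorem run_add (W : ℕ) (x y : V) (b : Bool) (v : V → ℕ) :
    ((add x y : SweepOp V O).run b (digitVecs W v)).2 =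
      (digitVecs W (Function.update v x (v x + v y + b.toNat)), []) := by
  induction W generalizing v b with
  | zero => rfl
  | succ W ih =>
    rw [digitVecs_succ_update]
    simp only [run, digitVecs]
    rw [ih]
    rcases Nat.mod_two_eq_zero_or_one (v x) with h | h <;>
      rcases Nat.mod_two_eq_zero_or_one (v y) with h' | h' <;> cases b <;>
      simp [add, h, h', Nat.add_mod] <;> congr 2 <;> omega

end SweepOp

end Arithmetic

namespace SweepOp

variable {V O : Type}

/-- Digits arrive with the least significant first, so a differing digit overrides the verdict on
all lower ones, which is kept in the memory bit. The initial bit decides the case of equality. -/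
theorem run_compare (W : ℕ) (x y : V) (b₀ b : Bool) {v : V → ℕ} (hx : v x < 2 ^ W)
    (hy : v y < 2 ^ W) : (compare b₀ x y : SweepOp V O).run b (digitVecs W v) =
      (decide (v x < v y + b.toNat), digitVecs W v, []) := by
  induction W generalizing v b with
  | zero =>
    have hx : v x = 0 := by simpa using hx
    have hy : v y = 0 := by simpa using hy
    cases b <;> simp [run, digitVecs, hx, hy]
  | succ W ih =>
    rw [pow_succ] at hx hy
    simp only [digitVecs, run]
    rw [show ∀ d, ((compare b₀ x y : SweepOp V O).digit b d) =
      (if d x = d y then b else d y, d, []) from fun _ => rfl]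
    simp only
    rw [ih (v := fun x => v x / 2) _ (by omega) (by omega)]
    rcases Nat.mod_two_eq_zero_or_one (v x) with h | h <;>
      rcases Nat.mod_two_eq_zero_or_one (v y) with h' | h' <;> cases b <;>
      simp [h, h'] <;> omega

theorem run_equal (W : ℕ) (x y : V) (b : Bool) {v : V → ℕ} (hx : v x < 2 ^ W)
    (hy : v y < 2 ^ W) : (equal x y : SweepOp V O).run b (digitVecs W v) =
      (b && decide (v x = v y), digitVecs W v, []) := by
  induction W generalizing v b with
  | zero =>
    have hx : v x = 0 := by simpa using hx
    have hy : v y = 0 := by simpa using hy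
    simp [run, digitVecs, hx, hy]
  | succ W ih =>
    rw [pow_succ] at hx hy
    simp only [digitVecs, run]
    rw [show ∀ d, ((equal x y : SweepOp V O).digit b d) =
      (b && d x == d y, d, []) from fun _ => rfl]
    simp only
    rw [ih (v := fun x => v x / 2) _ (by omega) (by omega)]
    rcases Nat.mod_two_eq_zero_or_one (v x) with h | h <;>
      rcases Nat.mod_two_eq_zero_or_one (v y) with h' | h' <;> cases b <;>
      simp [h, h'] <;> omega

theorem run_meet (W : ℕ) (x y : V) (b : Bool) {v : V → ℕ} (hx : v x < 2 ^ W) :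
    (meet x y : SweepOp V O).run b (digitVecs W v) =
      (b || decide (v x &&& v y ≠ 0), digitVecs W v, []) := by
  induction W generalizing v b with
  | zero =>
    have hx : v x = 0 := by simpa using hx
    simp [run, digitVecs, hx]
  | succ W ih =>
    rw [pow_succ] at hx
    simp only [digitVecs, run]
    rw [show ∀ d, ((meet x y : SweepOp V O).digit b d) =
      (b || (d x && d y), d, []) from fun _ => rfl]
    simp only
    rw [ih (v := fun x => v x / 2) _ (by omega)]
    have h1 := Nat.and_div_two (a := v x) (b := v y)
    have h2 := Nat.and_mod_two_eq_one (a := v x) (b := v y)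
    rw [← h1, Bool.or_assoc]
    simp only [ne_eq, List.nil_append, Prod.mk.injEq, and_true]
    congr 1
    rw [Bool.eq_iff_iff]
    simp only [Bool.or_eq_true, Bool.and_eq_true, decide_eq_true_eq]
    rw [← h2]
    omega

/-- A power of two in `y` marks a single position of the word, so exactly one digit of `x` is
written. -/
theorem run_emitAt (W : ℕ) (f : Bool → O) (x y : V) (b : Bool) {v : V → ℕ} {j : ℕ} (hj : j < W)
    (hy : v y = 2 ^ j) : (emitAt f x y).run b (digitVecs W v) =
      (b, digitVecs W v, [f ((v x).testBit j)]) := by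
  have hd : ∀ b d, ((emitAt f x y).digit b d) =
      (b, d, if d y then [f (d x)] else []) := fun _ _ => rfl
  have none : ∀ (W : ℕ) (v : V → ℕ), v y = 0 → (emitAt f x y).run b (digitVecs W v) =
      (b, digitVecs W v, []) := by
    intro W
    induction W with
    | zero => intro v _; rfl
    | succ W ih =>
      intro v hv
      simp only [digitVecs, run, hd]
      rw [ih (fun x => v x / 2) (by simp [hv])]
      simp [hv]
  induction W generalizing v j with
  | zero => omega
  | succ W ih =>
    simp only [digitVecs, run, hd]
    rcases j with _ | j
    · rw [none W (fun x => v x / 2) (by simp [hy])]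
      simp [hy, Nat.testBit_zero]
    · rw [ih (v := fun x => v x / 2) (j := j) (by omega) (by simp only [hy]; rw [pow_succ]; omega)]
      have : 2 ^ (j + 1) % 2 = 0 := by rw [pow_succ]; omega
      simp [hy, this, Nat.testBit_add_one]

theorem run_emitAll (W : ℕ) (f : (V → Bool) → List O) (b : Bool) (v : V → ℕ) :
    (emitAll f).run b (digitVecs W v) = (b, digitVecs W v, (digitVecs W v).flatMap f) := by
  generalize digitVecs W v = l
  induction l with
  | nil => rfl
  | cons d l ih =>
    simp only [run, List.flatMap_cons]
    simp [emitAll] at *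
    simp [ih]

end SweepOp

/-! ### Programs over registers -/

section Runs

variable {V O : Type}

/-- The program turns the register contents `v` into `v'`, with numbers of `W` binary digits. -/
def Prog.Runs (W : ℕ) (p : Prog V O) (v v' : V → ℕ) (o : List O) : Prop :=
  p.Exec (digitVecs W v) (digitVecs W v') o

namespace Prog.Runs

variable {W : ℕ} {p q : Prog V O} {v v' v'' : V → ℕ} {o o' : List O} {M : SweepOp V O}

theorem congr (h : p.Runs W v v' o) (e : o = o') : p.Runs W v v' o' := e ▸ h

theorem emit (w : List O) (v : V → ℕ) : (Prog.emit w).Runs W v v w := Exec.emit _ _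

theorem seq (hp : p.Runs W v v' o) (hq : q.Runs W v' v'' o') :
    (Prog.seq p q).Runs W v v'' (o ++ o') := Exec.seq hp hq

theorem op (h : (M.run M.start (digitVecs W v)).2 = (digitVecs W v', o)) :
    (Prog.op M).Runs W v v' o := by
  have := Exec.op M (digitVecs W v)
  rw [h] at this
  exact this

theorem ite {b : Bool} (h : M.run M.start (digitVecs W v) = (b, digitVecs W v, []))
    (hp : b = true → p.Runs W v v' o) (hq : b = false → q.Runs W v v' o) :
    (Prog.ite M p q).Runs W v v' o := by
  cases b with
  | true =>
    have := Exec.ite_true (M := M) (p := p) (q := q) (l := digitVecs W v) (by rw [h])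
      (by rw [h]; exact hp rfl)
    rw [h] at this
    exact this
  | false =>
    have := Exec.ite_false (M := M) (p := p) (q := q) (l := digitVecs W v) (by rw [h])
      (by rw [h]; exact hq rfl)
    rw [h] at this
    exact this

theorem loop {n : ℕ} {s : ℕ → V → ℕ} {out : ℕ → List O}
    (hM : ∀ i ≤ n, M.run M.start (digitVecs W (s i)) = (decide (i < n), digitVecs W (s i), []))
    (hp : ∀ i < n, p.Runs W (s i) (s (i + 1)) (out i)) :
    (Prog.loop M p).Runs W (s 0) (s n) ((List.range n).flatMap out) := by
  induction n generalizing s out with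
  | zero =>
    have h := hM 0 le_rfl
    have := Exec.loop_false (M := M) (p := p) (l := digitVecs W (s 0)) (by rw [h]; rfl)
    rw [h] at this
    exact this
  | succ n ih =>
    have h := hM 0 (by omega)
    have h1 := ih (s := fun i => s (i + 1)) (out := fun i => out (i + 1))
      (fun i hi => by rw [hM _ (by omega)]; simp) (fun i hi => hp _ (by omega))
    have h2 : p.Exec (M.run M.start (digitVecs W (s 0))).2.1 (digitVecs W (s 1)) (out 0) := by
      rw [h]; exact hp 0 (by omega)
    have := Exec.loop_true (M := M) (by rw [h]; simp) h2 h1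
    rw [h] at this
    rw [List.range_succ_eq_map, List.flatMap_cons, List.flatMap_map]
    exact this

section

variable [DecidableEq V] {x y : V}

theorem zero (e : Function.update v x 0 = v') :
    (Prog.op (SweepOp.zero x) : Prog V O).Runs W v v' [] :=
  op (by rw [SweepOp.run_zero, e])

theorem copy (e : Function.update v x (v y) = v') :
    (Prog.op (SweepOp.copy x y) : Prog V O).Runs W v v' [] :=
  op (by rw [SweepOp.run_copy, e])

theorem inc (e : Function.update v x (v x + 1) = v') :
    (Prog.op (SweepOp.inc x) : Prog V O).Runs W v v' [] :=
  op (by rw [SweepOp.run_inc, ← e]; rfl)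

theorem add (e : Function.update v x (v x + v y) = v') :
    (Prog.op (SweepOp.add x y) : Prog V O).Runs W v v' [] :=
  op (by rw [SweepOp.run_add, ← e]; rfl)

end

end Prog.Runs

end Runs

/-! ### Printing the circuit of a formula -/

/-- One register for each variable, and registers for the number of input bits, the number of
vertices and three auxiliary numbers. -/
abbrev Reg (c : ℕ) : Type :=
  Fin c ⊕ Fin 5

section Printing

variable {c : ℕ}

def store (N m : ℕ) (a : Fin c → ℕ) (t k h : ℕ) : Reg c → ℕ :=
  Sum.elim a ![N, m, t, k, h]

section

variable (N m : ℕ) (a : Fin c → ℕ) (t k h i : ℕ)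

@[simp] theorem store_inl (x : Fin c) : store N m a t k h (.inl x) = a x := rfl
@[simp] theorem store_input : store N m a t k h (.inr 0) = N := rfl
@[simp] theorem store_vertices : store N m a t k h (.inr 1) = m := rfl
@[simp] theorem store_index : store N m a t k h (.inr 2) = t := rfl
@[simp] theorem store_count : store N m a t k h (.inr 3) = k := rfl
@[simp] theorem store_power : store N m a t k h (.inr 4) = h := rfl

@[simp] theorem store_update_inl (x : Fin c) : Function.update (store N m a t k h) (.inl x) i =
    store N m (Function.update a x i) t k h := by
  funext r
  rcases r with r | r
  · by_cases e : r = x <;> simp [store, e]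
  · rw [Function.update_of_ne (by simp)]; rfl

@[simp] theorem store_update_vertices : Function.update (store N m a t k h) (.inr 1) i =
    store N i a t k h := by
  funext r
  rcases r with r | r
  · rw [Function.update_of_ne (by simp)]; rfl
  · fin_cases r <;> simp [store, Function.update]

@[simp] theorem store_update_index : Function.update (store N m a t k h) (.inr 2) i =
    store N m a i k h := by
  funext r
  rcases r with r | r
  · rw [Function.update_of_ne (by simp)]; rfl
  · fin_cases r <;> simp [store, Function.update]

@[simp] theorem store_update_count : Function.update (store N m a t k h) (.inr 3) i =
    store N m a t i h := by
  funext r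
  rcases r with r | r
  · rw [Function.update_of_ne (by simp)]; rfl
  · fin_cases r <;> simp [store, Function.update]

@[simp] theorem store_update_power : Function.update (store N m a t k h) (.inr 4) i =
    store N m a t k i := by
  funext r
  rcases r with r | r
  · rw [Function.update_of_ne (by simp)]; rfl
  · fin_cases r <;> simp [store, Function.update]

end

abbrev RegProg (c : ℕ) : Type :=
  Prog (Reg c) CircuitSymbol

/-- The register contents between the parts of the program. -/
abbrev baseStore (N : ℕ) (a : Fin c → ℕ) : Reg c → ℕ :=
  store N N.sqrt a 0 0 0

theorem sqrt_lt_two_pow (N : ℕ) : N.sqrt < 2 ^ labelWidth N := by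
  have := lt_two_pow_labelWidth N
  have := Nat.sqrt_le_self N
  omega

/-- Runs `p` for all values of the variable `x`. -/
def forVar (x : Fin c) (p : RegProg c) : RegProg c :=
  .seq (.loop (.compare false (.inl x) (.inr 1)) (.seq p (.op (.inc (.inl x)))))
    (.op (.zero (.inl x)))

/-- The loop variable is `0` before and after, so such loops can be nested. The counter register may
hold an arbitrary `k`, because the printing of a quantifier gate saves a variable there. -/
theorem runs_forVar {N : ℕ} {a : Fin c → ℕ} {k : ℕ} {x : Fin c} (hx : a x = 0) {p : RegProg c}
    {out : ℕ → List CircuitSymbol}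
    (hp : ∀ i < N.sqrt, p.Runs (labelWidth N) (store N N.sqrt (Function.update a x i) 0 k 0)
      (store N N.sqrt (Function.update a x i) 0 k 0) (out i)) :
    (forVar x p).Runs (labelWidth N) (store N N.sqrt a 0 k 0) (store N N.sqrt a 0 k 0)
      ((List.range N.sqrt).flatMap out) := by
  have h := Prog.Runs.loop (W := labelWidth N) (M := .compare false (.inl x) (.inr 1))
    (p := .seq p (.op (.inc (.inl x)))) (n := N.sqrt) (out := out)
    (s := fun i => store N N.sqrt (Function.update a x i) 0 k 0) (fun i hi => by
      have := sqrt_lt_two_pow N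
      rw [SweepOp.run_compare]
      · simp [SweepOp.compare]
      · simp; omega
      · simpa using this)
    (fun i hi => ((hp i hi).seq (Prog.Runs.inc (by simp))).congr (by simp))
  have e : Function.update a x 0 = a := by rw [← hx, Function.update_eq_self]
  have h2 := h.seq (Prog.Runs.zero (O := CircuitSymbol) (x := .inl x) (by simp; rfl))
  simpa [e, forVar] using h2

def emitLabel (p : List Bool) : RegProg c :=
  .seq (.emit (p.map .bit))
    (.op (.emitAll fun d => (List.ofFn fun x => d (.inl x)).map .bit))

theorem runs_emitLabel (N : ℕ) (p : List Bool) (m : ℕ) (a : Fin c → ℕ) (t k h : ℕ) :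
    (emitLabel p : RegProg c).Runs (labelWidth N) (store N m a t k h) (store N m a t k h)
      ((gateLabel N p a).map .bit) := by
  rw [gateLabel, List.map_append]
  refine (Prog.Runs.emit _ _).seq (Prog.Runs.op ?_)
  rw [SweepOp.run_emitAll]
  have key : ∀ (W : ℕ) (v : Reg c → ℕ), (digitVecs W v).flatMap
      (fun d => (List.ofFn fun x => d (.inl x)).map CircuitSymbol.bit) =
        (assignmentWord W fun x => v (.inl x)).map .bit := by
    intro W
    unfold assignmentWord
    induction W with
    | zero => intro v; rfl
    | succ W ih =>
      intro v
      simp only [digitVecs, List.flatMap_cons, List.map_append]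
      rw [ih]
  exact Prod.ext rfl (key _ _)

def forAssignments : List (Fin c) → RegProg c → RegProg c
  | [], p => p
  | x :: xs, p => forVar x (forAssignments xs p)

theorem runs_forAssignments {N : ℕ} {xs : List (Fin c)} (hxs : xs.Nodup) {a : Fin c → ℕ}
    (ha : ∀ x ∈ xs, a x = 0) {p : RegProg c} {out : (Fin c → ℕ) → List CircuitSymbol}
    (hp : ∀ b ∈ assignments N.sqrt xs a,
      p.Runs (labelWidth N) (baseStore N b) (baseStore N b) (out b)) :
    (forAssignments xs p).Runs (labelWidth N) (baseStore N a) (baseStore N a)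
      ((assignments N.sqrt xs a).flatMap out) := by
  induction xs generalizing a with
  | nil => simpa [assignments, forAssignments] using hp a (by simp [assignments])
  | cons x xs ih =>
    rw [List.nodup_cons] at hxs
    have := runs_forVar (N := N) (k := 0) (x := x) (ha x (by simp)) (p := forAssignments xs p)
      (out := fun i => (assignments N.sqrt xs (Function.update a x i)).flatMap out)
      (fun i hi => ih hxs.2 (fun y hy => by
          have : y ≠ x := fun e => hxs.1 (e ▸ hy)
          rw [Function.update_of_ne this]
          exact ha y (by simp [hy]))
        (fun b hb => hp b (by
          simp only [assignments, List.mem_flatMap, List.mem_range]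
          exact ⟨i, hi, hb⟩)))
    rw [assignments, List.flatMap_assoc]
    exact this

theorem bits_eq_map_testBit (n : ℕ) : n.bits = (List.range n.size).map n.testBit := by
  refine List.ext_getElem (by simp [Nat.size_eq_bits_len]) fun i h1 h2 => ?_
  rw [List.getElem_map, List.getElem_range, Nat.testBit_eq_inth, List.getI_eq_getElem _ h1]

/-- Writes the binary digits of the auxiliary number and sets it to `0`. -/
def emitIndex : RegProg c :=
  .seq (.op (.inc (.inr 4)))
    (.seq (.loop (.compare true (.inr 4) (.inr 2))
      (.seq (.op (.emitAt .bit (.inr 2) (.inr 4))) (.op (.add (.inr 4) (.inr 4)))))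
      (.seq (.op (.zero (.inr 4))) (.op (.zero (.inr 2)))))

/-- Since `2 ^ i ≤ t` exactly when `i < t.size`, the loop writes as many digits as `Nat.bits` has,
in particular none for `t = 0`. -/
theorem runs_emitIndex {N t : ℕ} (ht : t ≤ N) (a : Fin c → ℕ) :
    (emitIndex : RegProg c).Runs (labelWidth N) (store N N.sqrt a t 0 0) (baseStore N a)
      (t.bits.map .bit) := by
  have hN := lt_two_pow_labelWidth N
  have hsz : t.size ≤ N.size := Nat.size_le_size ht
  have h := Prog.Runs.loop (W := labelWidth N) (M := .compare true (.inr 4) (.inr 2))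
    (p := .seq (.op (.emitAt CircuitSymbol.bit (.inr 2) (.inr 4))) (.op (.add (.inr 4) (.inr 4))))
    (n := t.size) (out := fun i => [.bit (t.testBit i)])
    (s := fun i => store N N.sqrt a t 0 (2 ^ i)) (fun i hi => by
      rw [SweepOp.run_compare]
      · simp [SweepOp.compare, Nat.lt_size]
      · simp only [store_power]
        exact Nat.pow_lt_pow_right (by norm_num) (by rw [labelWidth]; omega)
      · simp only [store_index]; omega)
    (fun i hi => by
      refine Prog.Runs.congr (o := [.bit (t.testBit i)] ++ []) ?_ (by simp)
      refine Prog.Runs.seq (v' := store N N.sqrt a t 0 (2 ^ i)) (Prog.Runs.op ?_)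
        (Prog.Runs.add (by simp [pow_succ, mul_two]))
      rw [SweepOp.run_emitAt (j := i) _ _ _ _ _ (by rw [labelWidth]; omega) (by simp)]
      simp)
  refine Prog.Runs.congr (o := [] ++ ((List.range t.size).flatMap (fun i => [.bit (t.testBit i)]) ++
    ([] ++ []))) ?_ ?_
  · exact (Prog.Runs.inc (v' := store N N.sqrt a t 0 (2 ^ 0)) (by simp)).seq
      (h.seq ((Prog.Runs.zero (v' := store N N.sqrt a t 0 0) (by simp)).seq
        (Prog.Runs.zero (by simp))))
  · rw [bits_eq_map_testBit]
    simp only [List.nil_append, List.append_nil, List.map_map]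
    rw [← List.map_eq_flatMap]
    rfl

/-- Sets the auxiliary number to the position of the pair `(x, y)` in the adjacency matrix. -/
def computeIndex (x y : Fin c) : RegProg c :=
  .seq (.loop (.compare false (.inr 3) (.inl x))
      (.seq (.op (.add (.inr 2) (.inr 1))) (.op (.inc (.inr 3)))))
    (.seq (.op (.zero (.inr 3))) (.op (.add (.inr 2) (.inl y))))

theorem runs_computeIndex {N : ℕ} {a : Fin c → ℕ} (ha : ∀ x, a x < N.sqrt) (x y : Fin c) :
    (computeIndex x y).Runs (labelWidth N) (baseStore N a)
      (store N N.sqrt a (a x * N.sqrt + a y) 0 0) [] := by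
  have hN := sqrt_lt_two_pow N
  have hx := ha x
  have h := Prog.Runs.loop (W := labelWidth N) (M := .compare false (.inr 3) (.inl x))
    (p := .seq (.op (.add (.inr 2) (.inr 1))) (.op (.inc (.inr 3))))
    (n := a x) (out := fun i => ([] : List CircuitSymbol))
    (s := fun i => store N N.sqrt a (i * N.sqrt) i 0) (fun i hi => by
      rw [SweepOp.run_compare]
      · simp [SweepOp.compare]
      · simp; omega
      · simp; omega)
    (fun i hi => (Prog.Runs.add (v' := store N N.sqrt a ((i + 1) * N.sqrt) i 0)
      (by simp [add_mul])).seq (Prog.Runs.inc (by simp)))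
  refine Prog.Runs.congr (o := (List.range (a x)).flatMap (fun i => []) ++ ([] ++ [])) ?_ (by simp)
  rw [zero_mul] at h
  exact h.seq ((Prog.Runs.zero (v' := store N N.sqrt a (a x * N.sqrt) 0 0) (by simp)).seq
    (Prog.Runs.add (by simp)))

/-! ### Programs that print the gates of a formula -/

namespace Formula

/-- All numerical predicates in the formula are decided by passes over the binary digits. -/
def IsUniform : Formula c → Prop
  | adj _ _ => True
  | num p => ∃ M : SweepOp (Reg c) CircuitSymbol, ∀ (W : ℕ) (v : Reg c → ℕ), (∀ r, v r < 2 ^ W) →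
      M.run M.start (digitVecs W v) = (p fun x => v (.inl x), digitVecs W v, [])
  | not φ => φ.IsUniform
  | and φ ψ => φ.IsUniform ∧ ψ.IsUniform
  | ex _ φ => φ.IsUniform

/-- One program serves all `N`: the position `p` is a constant word of the program, while the digits
of the assignment are read from the registers. -/
theorem exists_prog_gate {φ : Formula c} (hφ : φ.IsUniform) (p : List Bool) :
    ∃ P : RegProg c, ∀ (N : ℕ) (a : Fin c → ℕ), (∀ x, a x < N.sqrt) →
      P.Runs (labelWidth N) (baseStore N a) (baseStore N a)
        (Gate.encode ⟨gateLabel N p a, φ.topOp N p a⟩) := by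
  suffices h : ∃ P : RegProg c, ∀ (N : ℕ) (a : Fin c → ℕ), (∀ x, a x < N.sqrt) →
      P.Runs (labelWidth N) (baseStore N a) (baseStore N a) (φ.topOp N p a).encode by
    obtain ⟨P, hP⟩ := h
    refine ⟨.seq (emitLabel p) (.seq P (.emit [.endGate])), fun N a ha => ?_⟩
    rw [Gate.encode, List.append_assoc]
    exact (runs_emitLabel N p _ a 0 0 0).seq ((hP N a ha).seq (Prog.Runs.emit _ _))
  cases φ with
  | adj x y =>
    refine ⟨.seq (.emit [.input]) (.seq (computeIndex x y) emitIndex), fun N a ha => ?_⟩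
    have hlt : a x * N.sqrt + a y < N := by
      have h1 := Nat.sqrt_le N
      have h2 := Nat.mul_le_mul_right N.sqrt (Nat.succ_le_iff.2 (ha x))
      have h3 := ha y
      rw [Nat.succ_mul] at h2
      omega
    simp only [topOp, inputOp, hlt, dite_true, GateOp.encode]
    exact (Prog.Runs.emit [.input] _).seq ((runs_computeIndex ha x y).seq
      (runs_emitIndex hlt.le a))
  | num q =>
    obtain ⟨M, hM⟩ := hφ
    refine ⟨.ite M (.emit [.and]) (.emit [.or]), fun N a ha => ?_⟩
    have hs := sqrt_lt_two_pow N
    have hN := lt_two_pow_labelWidth N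
    refine Prog.Runs.ite (hM _ _ ?_) (fun h => ?_) (fun h => ?_)
    · rintro (r | r)
      · have := ha r; simp; omega
      · fin_cases r
        · simp; omega
        · simpa using hs
        all_goals simp
    · simp only [store_inl] at h
      simp only [topOp, h, if_true, GateOp.encode, List.flatMap_nil]
      exact Prog.Runs.emit _ _
    · simp only [store_inl] at h
      simp only [topOp, h, GateOp.encode, Bool.false_eq_true, if_false, List.flatMap_nil]
      exact Prog.Runs.emit _ _
  | not φ =>
    refine ⟨.seq (.emit [.not]) (emitLabel (p ++ [false])), fun N a ha => ?_⟩
    exact (Prog.Runs.emit [.not] _).seq (runs_emitLabel N _ _ a 0 0 0)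
  | and φ ψ =>
    refine ⟨.seq (.emit [.and]) (.seq (.seq (emitLabel (p ++ [false])) (.emit [.comma]))
      (.seq (emitLabel (p ++ [true])) (.emit [.comma]))), fun N a ha => ?_⟩
    refine Prog.Runs.congr ((Prog.Runs.emit [.and] _).seq
      (((runs_emitLabel N _ _ a 0 0 0).seq (Prog.Runs.emit [.comma] _)).seq
      ((runs_emitLabel N _ _ a 0 0 0).seq (Prog.Runs.emit [.comma] _)))) ?_
    simp [topOp, GateOp.encode]
  | ex x φ =>
    -- The loop over the arguments of the OR gate overwrites the variable `x`; its value waits in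
    -- the counter register and is restored afterwards.
    refine ⟨.seq (.emit [.or]) (.seq (.op (.copy (.inr 3) (.inl x))) (.seq (.op (.zero (.inl x)))
      (.seq (forVar x (.seq (emitLabel (p ++ [false])) (.emit [.comma])))
        (.seq (.op (.copy (.inl x) (.inr 3))) (.op (.zero (.inr 3))))))), fun N a ha => ?_⟩
    have h := runs_forVar (N := N) (k := a x) (x := x) (a := Function.update a x 0) (by simp)
      (p := .seq (emitLabel (p ++ [false])) (.emit [.comma])) (fun i hi =>
        (runs_emitLabel N (p ++ [false]) _ _ 0 (a x) 0).seq
          (Prog.Runs.emit [CircuitSymbol.comma] _))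
    refine Prog.Runs.congr ((Prog.Runs.emit [.or] _).seq
      ((Prog.Runs.copy (v' := store N N.sqrt a 0 (a x) 0) (by simp)).seq
        ((Prog.Runs.zero (v' := store N N.sqrt (Function.update a x 0) 0 (a x) 0) (by simp)).seq
          (h.seq ((Prog.Runs.copy (v' := store N N.sqrt a 0 (a x) 0) (by simp)).seq
            (Prog.Runs.zero (by simp))))))) ?_
    simp [topOp, GateOp.encode, List.flatMap_map]

theorem exists_prog_gates {φ : Formula c} (hφ : φ.IsUniform) (p : List Bool) :
    ∃ P : RegProg c, ∀ N : ℕ, P.Runs (labelWidth N) (baseStore N 0) (baseStore N 0)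
      ((φ.gates N p).flatMap Gate.encode) := by
  have key : ∀ {φ : Formula c} {p : List Bool} {P₀ : RegProg c}, φ.IsUniform →
      (∀ N : ℕ, P₀.Runs (labelWidth N) (baseStore N 0) (baseStore N 0)
        ((φ.subGates N p).flatMap Gate.encode)) →
      ∃ P : RegProg c, ∀ N : ℕ, P.Runs (labelWidth N) (baseStore N 0) (baseStore N 0)
        ((φ.gates N p).flatMap Gate.encode) := by
    intro φ p P₀ hφ h
    obtain ⟨P, hP⟩ := exists_prog_gate hφ p
    refine ⟨.seq P₀ (forAssignments (List.finRange c) P), fun N => ?_⟩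
    rw [gates_eq, List.flatMap_append]
    refine (h N).seq ?_
    rw [gateLayer, List.flatMap_map]
    exact runs_forAssignments (List.nodup_finRange c) (fun _ _ => rfl)
      fun b hb => hP N b (mem_allAssignments.1 hb)
  induction φ generalizing p with
  | adj x y => exact key hφ fun N => Prog.Runs.emit [] _
  | num q => exact key hφ fun N => Prog.Runs.emit [] _
  | not φ ih =>
    obtain ⟨P, hP⟩ := ih hφ (p ++ [false])
    exact key hφ hP
  | and φ ψ ih1 ih2 =>
    obtain ⟨P, hP⟩ := ih1 hφ.1 (p ++ [false])
    obtain ⟨P', hP'⟩ := ih2 hφ.2 (p ++ [true])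
    refine key (P₀ := .seq P P') hφ fun N => ?_
    simp only [subGates, List.flatMap_append]
    exact (hP N).seq (hP' N)
  | ex x φ ih =>
    obtain ⟨P, hP⟩ := ih hφ (p ++ [false])
    exact key hφ hP

end Formula

/-- Sets the register for the number of vertices to `√N`. -/
def computeSqrt : RegProg c :=
  .seq (.loop (.compare false (.inr 2) (.inr 0)) (.seq (.op (.inc (.inr 1)))
    (.seq (.op (.add (.inr 2) (.inr 1)))
      (.seq (.op (.add (.inr 2) (.inr 1))) (.op (.inc (.inr 2)))))))
    (.op (.zero (.inr 2)))

/-- After `i` rounds the auxiliary number is `(i + 1) ^ 2 - 1`, kept up to date by additions alone.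
It is below `N` if and only if `(i + 1) ^ 2 ≤ N`, that is, `i < N.sqrt`. -/
theorem runs_computeSqrt (N : ℕ) (a : Fin c → ℕ) :
    (computeSqrt : RegProg c).Runs (labelWidth N) (store N 0 a 0 0 0) (baseStore N a) [] := by
  have hN := lt_two_pow_labelWidth N
  have h := Prog.Runs.loop (W := labelWidth N) (M := .compare false (.inr 2) (.inr 0))
    (p := (.seq (.op (.inc (.inr 1)))
    (.seq (.op (.add (.inr 2) (.inr 1)))
      (.seq (.op (.add (.inr 2) (.inr 1))) (.op (.inc (.inr 2)))))))
    (n := N.sqrt) (out := fun i => ([] : List CircuitSymbol))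
    (s := fun i => store N i a (i * i + 2 * i) 0 0) (fun i hi => by
      have h1 := Nat.sqrt_le N
      have h2 := Nat.mul_le_mul hi hi
      have h3 := Nat.sqrt_le_self N
      rw [SweepOp.run_compare]
      · simp only [SweepOp.compare, store_index, store_input, Bool.toNat_false, add_zero,
          Prod.mk.injEq, decide_eq_decide, and_true]
        rw [← Nat.succ_le_iff (m := i), Nat.le_sqrt, Nat.succ_eq_add_one,
          show (i + 1) * (i + 1) = i * i + 2 * i + 1 by ring]
        omega
      · simp only [store_index]; omega
      · simp only [store_input]; omega)
    (fun i hi => (Prog.Runs.inc (v' := store N (i + 1) a (i * i + 2 * i) 0 0) (by simp)).seq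
      ((Prog.Runs.add (v' := store N (i + 1) a (i * i + 2 * i + (i + 1)) 0 0) (by simp)).seq
        ((Prog.Runs.add (v' := store N (i + 1) a (i * i + 2 * i + (i + 1) + (i + 1)) 0 0)
          (by simp)).seq (Prog.Runs.inc (by
            simp only [store_update_index, store_index]
            congr 1
            ring)))))
  refine Prog.Runs.congr (o := (List.range N.sqrt).flatMap (fun i => []) ++ []) ?_ (by simp)
  exact h.seq (Prog.Runs.zero (by simp))

/-- Runs `p` for all powers of two below the number of vertices as values of the variable `z`. -/
def forPowers (z : Fin c) (p : RegProg c) : RegProg c :=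
  .seq (.op (.inc (.inl z))) (.seq (.loop (.compare false (.inl z) (.inr 1))
    (.seq p (.op (.add (.inl z) (.inl z))))) (.op (.zero (.inl z))))

theorem runs_forPowers {N : ℕ} {a : Fin c → ℕ} {z : Fin c} (hz : a z = 0) {p : RegProg c}
    {out : ℕ → List CircuitSymbol}
    (hp : ∀ b, p.Runs (labelWidth N) (baseStore N (Function.update a z (2 ^ b)))
      (baseStore N (Function.update a z (2 ^ b))) (out b)) :
    (forPowers z p).Runs (labelWidth N) (baseStore N a) (baseStore N a)
      ((List.range (Nat.clog 2 N.sqrt)).flatMap out) := by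
  have hs := sqrt_lt_two_pow N
  have h := Prog.Runs.loop (W := labelWidth N) (M := .compare false (.inl z) (.inr 1))
    (p := .seq p (.op (.add (.inl z) (.inl z)))) (n := Nat.clog 2 N.sqrt) (out := out)
    (s := fun i => baseStore N (Function.update a z (2 ^ i))) (fun i hi => by
      have hc : Nat.clog 2 N.sqrt ≤ N.size := by
        refine Nat.clog_le_of_le_pow ((Nat.sqrt_le_self N).trans (Nat.lt_size_self N).le)
      rw [SweepOp.run_compare]
      · simp [SweepOp.compare, two_pow_lt_iff_lt_clog]
      · simp only [store_inl, Function.update_self]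
        exact Nat.pow_lt_pow_right (by norm_num) (by rw [labelWidth]; omega)
      · simpa using hs)
    (fun i hi => ((hp i).seq (Prog.Runs.add (by simp [pow_succ, mul_two]))).congr (by simp))
  have e : Function.update a z 0 = a := by rw [← hz, Function.update_eq_self]
  refine Prog.Runs.congr (o := [] ++ ((List.range (Nat.clog 2 N.sqrt)).flatMap out ++ [])) ?_
    (by simp)
  exact (Prog.Runs.inc (by simp [hz])).seq (h.seq (Prog.Runs.zero (by simp [e])))

def emitOutput (p : List Bool) : RegProg c :=
  .seq (.emit [.output]) (emitLabel p)

theorem runs_emitOutput (N : ℕ) (p : List Bool) (a : Fin c → ℕ) :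
    (emitOutput p : RegProg c).Runs (labelWidth N) (baseStore N a) (baseStore N a)
      (.output :: (gateLabel N p a).map .bit) :=
  (Prog.Runs.emit [CircuitSymbol.output] _).seq (runs_emitLabel N p _ a 0 0 0)

theorem exists_prog_queryCircuit {x y z : Fin c} (hxy : x ≠ y) (hxz : x ≠ z) (hyz : y ≠ z)
    {φ ψ : Formula c} (hφ : φ.IsUniform) (hψ : ψ.IsUniform) :
    ∃ P : RegProg c, ∀ N : ℕ, P.Runs (labelWidth N) (store N 0 0 0 0 0) (baseStore N 0)
      (queryCircuit N x y z φ ψ).encode := by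
  obtain ⟨P, hP⟩ := Formula.exists_prog_gates hφ [false]
  obtain ⟨P', hP'⟩ := Formula.exists_prog_gates hψ [true]
  refine ⟨.seq computeSqrt (.seq (.seq P P') (.seq (forVar x (emitOutput [false]))
    (forVar x (forVar y (forPowers z (emitOutput [true])))))), fun N => ?_⟩
  have h1 := runs_forVar (N := N) (a := 0) (k := 0) (x := x) rfl
    (fun i hi => runs_emitOutput N [false] _)
  have h2 := runs_forVar (N := N) (a := 0) (k := 0) (x := x) rfl
    (fun u hu => runs_forVar (N := N) (a := Function.update 0 x u) (k := 0) (x := y)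
      (by rw [Function.update_of_ne hxy.symm]; rfl) (fun w hw => runs_forPowers (z := z)
        (by rw [Function.update_of_ne hyz.symm, Function.update_of_ne hxz.symm]; rfl)
        fun b => runs_emitOutput N [true] _))
  refine Prog.Runs.congr ((runs_computeSqrt N 0).seq (((hP N).seq (hP' N)).seq (h1.seq h2))) ?_
  simp [Circuit.encode, queryCircuit, List.flatMap_map, List.flatMap_assoc]

/-- Writes the word `ws[N]` if it exists, and runs `p` otherwise. -/
def withExceptions (p : RegProg c) : List (List CircuitSymbol) → RegProg c
  | [] => .seq (.op (.zero (.inr 2))) p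
  | w :: ws => .ite (.equal (.inr 2) (.inr 0)) (.emit w)
      (.seq (.op (.inc (.inr 2))) (withExceptions p ws))

/-- The auxiliary register counts the table entries that have been passed. The table ends without a
hit only if `N` is at least `t + ws.length`, which is where `p` has to be correct. -/
theorem runs_withExceptions {N : ℕ} {p : RegProg c} {v : Reg c → ℕ} {o : List CircuitSymbol}
    {ws : List (List CircuitSymbol)} {t : ℕ} (ht : t ≤ N)
    (hp : t + ws.length ≤ N → p.Runs (labelWidth N) (store N 0 0 0 0 0) v o)
    (hw : ∀ h : N - t < ws.length, ws[N - t] = o) :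
    ∃ v', (withExceptions p ws).Runs (labelWidth N) (store N 0 0 t 0 0) v' o := by
  have hN := lt_two_pow_labelWidth N
  induction ws generalizing t with
  | nil => exact ⟨v, (Prog.Runs.zero (by simp)).seq (hp (by simpa using ht))⟩
  | cons w ws ih =>
    have hM := SweepOp.run_equal (O := CircuitSymbol) (labelWidth N) (.inr 2) (.inr 0) true
      (v := (store N 0 0 t 0 0 : Reg c → ℕ)) (by simp; omega) (by simp; omega)
    by_cases h : t = N
    · subst h
      refine ⟨store t 0 0 t 0 0, Prog.Runs.ite hM (fun _ => ?_) (fun h => ?_)⟩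
      · have := hw (by simp)
        simp only [Nat.sub_self, List.getElem_cons_zero] at this
        rw [this]
        exact Prog.Runs.emit _ _
      · simp at h
    · obtain ⟨v', hv'⟩ := ih (t := t + 1) (by omega)
        (fun h' => hp (by rw [List.length_cons]; omega)) (fun h' => by
        have := hw (by rw [List.length_cons]; omega)
        rw [← this]
        have e : N - t = N - (t + 1) + 1 := by omega
        simp only [e, List.getElem_cons_succ])
      refine ⟨v', Prog.Runs.ite hM (fun h' => ?_) (fun _ => ?_)⟩
      · rw [Bool.true_and] at h'
        exact absurd (of_decide_eq_true h') h
      · exact (Prog.Runs.inc (by simp)).seq hv'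

theorem logspaceUniform_of_eventually_queryCircuit {x y z : Fin c} (hxy : x ≠ y) (hxz : x ≠ z)
    (hyz : y ≠ z) {φ ψ : Formula c} (hφ : φ.IsUniform) (hψ : ψ.IsUniform) {C : (N : ℕ) → Circuit N}
    {B : ℕ} (hC : ∀ N, B ≤ N → C N = queryCircuit N x y z φ ψ) : LogspaceUniform C := by
  obtain ⟨P, hP⟩ := exists_prog_queryCircuit hxy hxz hyz hφ hψ
  set ws : List (List CircuitSymbol) := (List.range B).map fun N => (C N).encode with hws
  refine ⟨progMachine (.inr 0) (withExceptions P ws), 6, fun N => ?_⟩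
  obtain ⟨v, hv⟩ := runs_withExceptions (N := N) (p := P) (v := baseStore N 0)
    (o := (C N).encode) (ws := ws) (t := 0) (Nat.zero_le N)
    (fun h => by
      rw [hC N (by simpa [hws] using h)]
      exact hP N)
    (fun h => by
      simp only [hws, List.getElem_map]
      exact congrArg (fun k => (C k).encode) (by simp))
  refine progMachine_outputsInSpace (l := digitVecs (labelWidth N) v) ?_
  rw [startWord_eq]
  have e : Function.update (0 : Reg c → ℕ) (.inr 0) N = (store N 0 0 0 0 0 : Reg c → ℕ) := by
    funext r
    rcases r with r | r
    · rw [Function.update_of_ne (by simp)]; rfl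
    · fin_cases r <;> simp [store, Function.update]
  rw [e]
  exact hv

end Printing

/-! ### Latin square graphs as nets -/

section Net

variable {V Q : Type}

/-- The graph `G` joins different points that agree in one of three coordinates, and any two
coordinates identify the set of points with the set of pairs. -/
structure IsNet (G : SimpleGraph V) (a b c : V → Q) : Prop where
  adj : ∀ p q, G.Adj p q ↔ p ≠ q ∧ (a p = a q ∨ b p = b q ∨ c p = c q)
  ab : Function.Bijective fun p => (a p, b p)
  bc : Function.Bijective fun p => (b p, c p)
  ca : Function.Bijective fun p => (c p, a p)

namespace IsNet

variable {G : SimpleGraph V} {a b c : V → Q}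

/-- Together with `swap` this yields all permutations of the coordinates, so geometric facts need a
proof only for the first one. -/
theorem rotate (h : IsNet G a b c) : IsNet G b c a where
  adj p q := by rw [h.adj]; tauto
  ab := h.bc
  bc := h.ca
  ca := h.ab

theorem swap (h : IsNet G a b c) : IsNet G b a c where
  adj p q := by rw [h.adj]; tauto
  ab := Prod.swap_bijective.comp h.ab
  bc := Prod.swap_bijective.comp h.ca
  ca := Prod.swap_bijective.comp h.bc

theorem ext (h : IsNet G a b c) {p q : V} (ha : a p = a q) (hb : b p = b q) : p = q :=
  h.ab.1 (Prod.ext ha hb)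

theorem exists_point (h : IsNet G a b c) (s t : Q) : ∃ p, a p = s ∧ b p = t := by
  obtain ⟨p, hp⟩ := h.ab.2 (s, t)
  exact ⟨p, congrArg Prod.fst hp, congrArg Prod.snd hp⟩

/-- Rows, columns and symbols may be named by three unrelated bijections: this is an isotopy, and
the graph only sees which points agree in a coordinate. -/
theorem exists_latinSquare (h : IsNet G a b c) {S : Type} (α β γ : S ≃ Q) :
    ∃ L : S → S → S, IsLatinSquare L ∧ Nonempty (G ≃g latinSquareGraph L) ∧
      ∀ x y z, L x y = z ↔ ∃ p, a p = α x ∧ b p = β y ∧ c p = γ z := by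
  choose f hfa hfb using h.exists_point
  have hL : ∀ x y z, γ.symm (c (f (α x) (β y))) = z ↔ ∃ p, a p = α x ∧ b p = β y ∧ c p = γ z := by
    intro x y z
    rw [Equiv.symm_apply_eq]
    constructor
    · exact fun e => ⟨_, hfa _ _, hfb _ _, e⟩
    · rintro ⟨p, h1, h2, h3⟩
      rw [h.ext ((hfa _ _).trans h1.symm) ((hfb _ _).trans h2.symm), h3]
  refine ⟨fun x y => γ.symm (c (f (α x) (β y))), ⟨fun x => ⟨?_, ?_⟩, fun y => ⟨?_, ?_⟩⟩, ⟨?_⟩, hL⟩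
  · intro y y' e
    have e := γ.symm.injective e
    have := h.rotate.rotate.ext e ((hfa _ _).trans (hfa _ _).symm)
    have := congrArg b this
    rw [hfb, hfb] at this
    exact β.injective this
  · intro z
    obtain ⟨p, h1, h2⟩ := h.rotate.rotate.exists_point (γ z) (α x)
    exact ⟨β.symm (b p), (hL _ _ _).2 ⟨p, h2, by simp, h1⟩⟩
  · intro x x' e
    have e := γ.symm.injective e
    have := h.rotate.ext ((hfb _ _).trans (hfb _ _).symm) e
    have := congrArg a this
    rw [hfa, hfa] at this
    exact α.injective this
  · intro z
    obtain ⟨p, h1, h2⟩ := h.rotate.exists_point (β y) (γ z)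
    exact ⟨α.symm (a p), (hL _ _ _).2 ⟨p, by simp, h1, h2⟩⟩
  · refine ⟨Equiv.ofBijective (fun p => ⟨(α.symm (a p), β.symm (b p), γ.symm (c p)),
      (hL _ _ _).2 ⟨p, by simp, by simp, by simp⟩⟩) ⟨?_, ?_⟩, ?_⟩
    · intro p q e
      simp only [Subtype.mk.injEq, Prod.mk.injEq, EmbeddingLike.apply_eq_iff_eq] at e
      exact h.ext e.1 e.2.1
    · rintro ⟨⟨x, y, z⟩, e⟩
      obtain ⟨p, h1, h2, h3⟩ := (hL _ _ _).1 e
      refine ⟨p, ?_⟩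
      simp [h1, h2, h3]
    · intro p q
      rw [h.adj]
      exact and_congr (EmbeddingLike.apply_eq_iff_eq _).not (or_congr α.symm.injective.eq_iff
        (or_congr β.symm.injective.eq_iff γ.symm.injective.eq_iff))

end IsNet

/-- The coordinates are row, column and symbol. That two of them determine a point bijectively holds
for row and column because `L` is a function, and for the other pairs by the Latin property. -/
theorem exists_isNet {W : Type} {L : Q → Q → Q} (hL : IsLatinSquare L) {G : SimpleGraph W}
    (e : G ≃g latinSquareGraph L) : ∃ a b c : W → Q, IsNet G a b c := by
  refine ⟨fun p => (e p).1.1, fun p => (e p).1.2.1, fun p => (e p).1.2.2, ?_, ?_, ?_, ?_⟩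
  · intro p q
    rw [← e.map_adj_iff]
    exact and_congr e.injective.ne_iff Iff.rfl
  · constructor
    · intro p q h
      simp only [Prod.mk.injEq] at h
      refine e.injective (Subtype.ext (Prod.ext h.1 (Prod.ext h.2 ?_)))
      rw [← (e p).2, ← (e q).2, h.1, h.2]
    · rintro ⟨s, t⟩
      exact ⟨e.symm ⟨(s, t, L s t), rfl⟩, by simp⟩
  · constructor
    · intro p q h
      simp only [Prod.mk.injEq] at h
      have h1 : (e p).1.1 = (e q).1.1 := by
        refine (hL.2 (e p).1.2.1).1 ?_
        have h2 := (e p).2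
        have h3 := (e q).2
        simp only
        rw [h2, h.2, ← h3, h.1]
      exact e.injective (Subtype.ext (Prod.ext h1 (Prod.ext h.1 h.2)))
    · rintro ⟨s, t⟩
      obtain ⟨i, hi⟩ := (hL.2 s).2 t
      exact ⟨e.symm ⟨(i, s, t), hi⟩, by simp⟩
  · constructor
    · intro p q h
      simp only [Prod.mk.injEq] at h
      have h1 : (e p).1.2.1 = (e q).1.2.1 := by
        refine (hL.1 (e p).1.1).1 ?_
        have h2 := (e p).2
        have h3 := (e q).2
        simp only
        rw [h2, h.1, ← h3, h.2]
      exact e.injective (Subtype.ext (Prod.ext h.2 (Prod.ext h1 h.1)))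
    · rintro ⟨t, s⟩
      obtain ⟨i, hi⟩ := (hL.1 s).2 t
      exact ⟨e.symm ⟨(s, i, t), hi⟩, by simp⟩

/-! ### Lines and parallel classes in terms of adjacency -/

/-- The point `w` lies on the line through the adjacent points `p` and `q`. -/
def OnLine (A : V → V → Prop) (p q w : V) : Prop :=
  (w = p ∨ w = q) ∨ (A w p ∧ A w q) ∧ ∃ s t, s ≠ t ∧
    (A s p ∧ A s q ∧ A s w) ∧ (A t p ∧ A t q ∧ A t w)

/-- The points `p` and `q` are equal, or joined by a line parallel to the one through `o` and
`u`. -/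
def SameClass (A : V → V → Prop) (o u p q : V) : Prop :=
  p = q ∨ A p q ∧ ((OnLine A p q o ∧ OnLine A p q u) ∨ ¬ ∃ w, OnLine A o u w ∧ OnLine A p q w)

/-- The points `p` and `q` are equal, or joined by a line that is parallel neither to the one
through `o` and `u` nor to the one through `o` and `v`. -/
def ThirdClass (A : V → V → Prop) (o u v p q : V) : Prop :=
  p = q ∨ A p q ∧ ¬ SameClass A o u p q ∧ ¬ SameClass A o v p q

/-- The entry of the recovered Latin square in row `x` and column `y` is `z`. -/
def Entry (A : V → V → Prop) (o u v x y z : V) : Prop :=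
  (SameClass A o u o x ∧ SameClass A o u o y ∧ SameClass A o u o z) ∧
    ∃ p s, (SameClass A o v o s ∧ ThirdClass A o u v x s) ∧ SameClass A o u s p ∧
      SameClass A o v p y ∧ ThirdClass A o u v p z

namespace IsNet

variable {G : SimpleGraph V} {a b c : V → Q}

/-- A third point of the line shares `n - 3 ≥ 2` neighbours with `p` and `q`, whereas a common
neighbour of `p` and `q` off the line shares at most one. -/
theorem onLine_iff [Finite Q] (hQ : 5 ≤ Nat.card Q) (h : IsNet G a b c) {p q : V}
    (hpq : G.Adj p q) (e : a p = a q) (w : V) : OnLine G.Adj p q w ↔ a w = a p := by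
  -- Off the line, a common neighbour meets `p` in one of the classes `b`, `c` and `q` in the other
  -- one; meeting both in the same class would force `p = q`.
  have other : ∀ {x : V}, G.Adj x p → G.Adj x q → a x ≠ a p →
      (b x = b p ∧ c x = c q) ∨ (b x = b q ∧ c x = c p) := by
    intro x h1 h2 hx
    have h1 := ((h.adj _ _).1 h1).2.resolve_left hx
    have h2 := ((h.adj _ _).1 h2).2.resolve_left (e ▸ hx)
    rcases h1 with h1 | h1 <;> rcases h2 with h2 | h2
    · exact absurd (h.ext e (h1.symm.trans h2)) hpq.ne
    · exact Or.inl ⟨h1, h2⟩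
    · exact Or.inr ⟨h2, h1⟩
    · exact absurd (h.rotate.rotate.ext (h1.symm.trans h2) e) hpq.ne
  constructor
  · rintro ((rfl | rfl) | ⟨⟨h1, h2⟩, s, t, hst, ⟨hs1, hs2, hs3⟩, ht1, ht2, ht3⟩)
    · rfl
    · exact e.symm
    · by_contra hw
      -- If `w` is one of the two off-line common neighbours, then a common neighbour of `p`, `q`
      -- and `w` can only be the other one. This forces `s = t`.
      have key : ∀ {x : V}, G.Adj x p → G.Adj x q → G.Adj x w →
          (b w = b p ∧ c w = c q → b x = b q ∧ c x = c p) ∧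
          (b w = b q ∧ c w = c p → b x = b p ∧ c x = c q) := by
        intro x hx1 hx2 hx3
        by_cases hx : a x = a p
        · have hx4 := ((h.adj _ _).1 hx3).2.resolve_left (fun e => hw (e.symm.trans hx))
          refine ⟨fun hw' => absurd hx4 ?_, fun hw' => absurd hx4 ?_⟩
          · rw [hw'.1, hw'.2]
            rintro (h4 | h4)
            · exact hx1.ne (h.ext hx h4)
            · exact hx2.ne (h.rotate.rotate.ext h4 (hx.trans e))
          · rw [hw'.1, hw'.2]
            rintro (h4 | h4)
            · exact hx2.ne (h.ext (hx.trans e) h4)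
            · exact hx1.ne (h.rotate.rotate.ext h4 hx)
        · rcases other hx1 hx2 hx with h5 | h5
          · refine ⟨fun hw' => absurd ?_ hx3.ne, fun _ => h5⟩
            exact h.rotate.ext (h5.1.trans hw'.1.symm) (h5.2.trans hw'.2.symm)
          · refine ⟨fun _ => h5, fun hw' => absurd ?_ hx3.ne⟩
            exact h.rotate.ext (h5.1.trans hw'.1.symm) (h5.2.trans hw'.2.symm)
      apply hst
      rcases other h1 h2 hw with h5 | h5
      · have h6 := (key hs1 hs2 hs3).1 h5
        have h7 := (key ht1 ht2 ht3).1 h5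
        exact h.rotate.ext (h6.1.trans h7.1.symm) (h6.2.trans h7.2.symm)
      · have h6 := (key hs1 hs2 hs3).2 h5
        have h7 := (key ht1 ht2 ht3).2 h5
        exact h.rotate.ext (h6.1.trans h7.1.symm) (h6.2.trans h7.2.symm)
  · intro hw
    by_cases hwp : w = p
    · exact Or.inl (Or.inl hwp)
    by_cases hwq : w = q
    · exact Or.inl (Or.inr hwq)
    have adj : ∀ {x y : V}, a x = a p → a y = a p → b x ≠ b y → G.Adj x y := by
      intro x y hx hy hxy
      exact (h.adj _ _).2 ⟨fun e => hxy (e ▸ rfl), Or.inl (hx.trans hy.symm)⟩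
    classical
    have := Fintype.ofFinite Q
    rw [Nat.card_eq_fintype_card] at hQ
    -- Points of the line correspond to `b`-values; three of at least five values are taken by `p`,
    -- `q` and `w`.
    have hcard : 1 < (Finset.univ \ {b p, b q, b w} : Finset Q).card := by
      have h1 := Finset.le_card_sdiff {b p, b q, b w} (Finset.univ : Finset Q)
      have h2 : ({b p, b q, b w} : Finset Q).card ≤ 3 := Finset.card_le_three
      rw [Finset.card_univ] at h1
      omega
    obtain ⟨s₀, hs, t₀, ht, hst⟩ := Finset.one_lt_card.1 hcard
    simp only [Finset.mem_sdiff, Finset.mem_univ, true_and, Finset.mem_insert,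
      Finset.mem_singleton, not_or] at hs ht
    obtain ⟨s, hs1, rfl⟩ := h.exists_point (a p) s₀
    obtain ⟨t, ht1, rfl⟩ := h.exists_point (a p) t₀
    refine Or.inr ⟨⟨adj hw rfl fun e' => hwp (h.ext hw e'),
      adj hw e.symm fun e' => hwq (h.ext (hw.trans e) e')⟩, s, t, fun e' => hst (e' ▸ rfl), ?_, ?_⟩
    · exact ⟨adj hs1 rfl hs.1, adj hs1 e.symm hs.2.1, adj hs1 hw hs.2.2⟩
    · exact ⟨adj ht1 rfl ht.1, adj ht1 e.symm ht.2.1, adj ht1 hw ht.2.2⟩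

/-- Distinct lines of one class are disjoint, while lines of different classes meet in a single
point. A line through both `o` and `u` is therefore the line `ou` itself, and a line disjoint from
`ou` is parallel to it. -/
theorem sameClass_iff [Finite Q] (hQ : 5 ≤ Nat.card Q) (h : IsNet G a b c) {o u : V}
    (hou : G.Adj o u) (e : a o = a u) (p q : V) : SameClass G.Adj o u p q ↔ a p = a q := by
  by_cases hpq : p = q
  · simp [SameClass, hpq]
  by_cases hadj : G.Adj p q
  · have hl := h.onLine_iff hQ hou e
    simp only [SameClass, hpq, hadj, false_or, true_and, hl]
    rcases ((h.adj _ _).1 hadj).2 with e' | e' | e'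
    · simp only [h.onLine_iff hQ hadj e', e', iff_true]
      by_cases ho : a o = a q
      · exact Or.inl ⟨ho, e ▸ ho⟩
      · exact Or.inr fun ⟨w, h1, h2⟩ => ho (h1.symm.trans h2)
    · simp only [h.rotate.onLine_iff hQ hadj e']
      refine iff_of_false ?_ fun h' => hpq (h.ext h' e')
      rintro (⟨h1, h2⟩ | h1)
      · exact hou.ne (h.ext e (h1.trans h2.symm))
      · obtain ⟨w, hw⟩ := h.exists_point (a o) (b p)
        exact h1 ⟨w, hw⟩
    · simp only [h.rotate.rotate.onLine_iff hQ hadj e']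
      refine iff_of_false ?_ fun h' => hpq (h.rotate.rotate.ext e' h')
      rintro (⟨h1, h2⟩ | h1)
      · exact hou.ne (h.rotate.rotate.ext (h1.trans h2.symm) e)
      · obtain ⟨w, hw⟩ := h.rotate.rotate.exists_point (c p) (a o)
        exact h1 ⟨w, hw.2, hw.1⟩
  · refine iff_of_false ?_ fun h' => hadj ((h.adj _ _).2 ⟨hpq, Or.inl h'⟩)
    rintro (h' | h')
    · exact hpq h'
    · exact hadj h'.1

theorem thirdClass_iff [Finite Q] (hQ : 5 ≤ Nat.card Q) (h : IsNet G a b c) {o u v : V}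
    (hou : G.Adj o u) (e : a o = a u) (hov : G.Adj o v) (e' : b o = b v) (p q : V) :
    ThirdClass G.Adj o u v p q ↔ c p = c q := by
  rw [ThirdClass, h.sameClass_iff hQ hou e, h.rotate.sameClass_iff hQ hov e', h.adj]
  constructor
  · rintro (h1 | ⟨⟨h1, h2⟩, h3, h4⟩)
    · rw [h1]
    · exact (h2.resolve_left h3).resolve_left h4
  · intro hc
    by_cases hpq : p = q
    · exact Or.inl hpq
    · exact Or.inr ⟨⟨hpq, Or.inr (Or.inr hc)⟩, fun h1 => hpq (h.rotate.rotate.ext hc h1),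
        fun h1 => hpq (h.rotate.ext h1 hc)⟩

/-- The points of a line are identified with the second coordinates. -/
noncomputable def lineEquiv (h : IsNet G a b c) (o : V) {P : V → Prop}
    (hP : ∀ x, P x ↔ a x = a o) : {x // P x} ≃ Q :=
  Equiv.ofBijective (fun x => b x.1)
    ⟨fun x y e => Subtype.ext (h.ext (((hP _).1 x.2).trans ((hP _).1 y.2).symm) e), fun t =>
      let ⟨p, h1, h2⟩ := h.exists_point (a o) t
      ⟨⟨p, (hP _).2 h1⟩, h2⟩⟩

theorem isNClique {n : ℕ} {a b c : V → Fin n} (h : IsNet G a b c) (o : V) {S : Finset V}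
    (hS : ∀ x, x ∈ S ↔ a x = a o) : G.IsNClique n S := by
  refine ⟨fun x hx y hy hxy => ?_, ?_⟩
  · exact (h.adj _ _).2 ⟨hxy, Or.inl (((hS x).1 hx).trans ((hS y).1 hy).symm)⟩
  · have := Fintype.card_congr (h.lineEquiv o hS)
    rwa [Fintype.card_fin, Fintype.card_coe] at this

theorem exists_latinSquare_entry [Finite Q] (hQ : 5 ≤ Nat.card Q) (h : IsNet G a b c) {o u v : V}
    (hou : G.Adj o u) (e : a o = a u) (hov : G.Adj o v) (e' : b o = b v) {P : V → Prop}
    (hP : ∀ x, P x ↔ a x = a o) :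
    ∃ L : {x // P x} → {x // P x} → {x // P x}, IsLatinSquare L ∧
      Nonempty (G ≃g latinSquareGraph L) ∧
      ∀ x y z, Entry G.Adj o u v x y z ↔
        ∃ (hx : P x) (hy : P y), (L ⟨x, hx⟩ ⟨y, hy⟩ : V) = z := by
  have hB : ∀ x, b x = b o ↔ b x = b o := fun _ => Iff.rfl
  -- Columns and symbols take the `b`- and `c`-values of the points on the line of `o`. For rows,
  -- `x` is sent along its `c`-line to the point `s` of the `b`-line of `o`, and then to the
  -- `a`-value of `s`.
  obtain ⟨L, h1, h2, h3⟩ := h.exists_latinSquare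
    ((h.rotate.rotate.swap.lineEquiv o hP).trans
      ((h.rotate.lineEquiv o hB).symm.trans (h.swap.lineEquiv o hB))) (h.lineEquiv o hP)
    (h.rotate.rotate.swap.lineEquiv o hP)
  refine ⟨L, h1, h2, fun x y z => ?_⟩
  have hs := h.sameClass_iff hQ hou e
  have hs' := h.rotate.sameClass_iff hQ hov e'
  have ht := h.thirdClass_iff hQ hou e hov e'
  have row : ∀ (x : {x // P x}) (s : V), b s = b o → c s = c x →
      (h.swap.lineEquiv o hB) ((h.rotate.lineEquiv o hB).symm
        (h.rotate.rotate.swap.lineEquiv o hP x)) = a s := by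
    intro x s hb hc
    have : (h.rotate.lineEquiv o hB).symm (h.rotate.rotate.swap.lineEquiv o hP x) = ⟨s, hb⟩ := by
      rw [Equiv.symm_apply_eq]
      exact hc.symm
    rw [this]
    rfl
  simp only [Entry, hs, hs', ht]
  constructor
  · rintro ⟨⟨hx, hy, hz⟩, p, s, ⟨hs1, hs2⟩, hp1, hp2, hp3⟩
    have hx := (hP x).2 hx.symm
    have hy := (hP y).2 hy.symm
    have hz := (hP z).2 hz.symm
    refine ⟨hx, hy, congrArg Subtype.val ((h3 ⟨x, hx⟩ ⟨y, hy⟩ ⟨z, hz⟩).2 ⟨p, ?_, hp2, hp3⟩)⟩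
    exact hp1.symm.trans (row ⟨x, hx⟩ s hs1.symm hs2.symm).symm
  · rintro ⟨hx, hy, rfl⟩
    obtain ⟨p, hp1, hp2, hp3⟩ := (h3 ⟨x, hx⟩ ⟨y, hy⟩ _).1 rfl
    obtain ⟨s, hs1, hs2⟩ := h.rotate.exists_point (b o) (c x)
    refine ⟨⟨((hP x).1 hx).symm, ((hP y).1 hy).symm, ((hP _).1 (L _ _).2).symm⟩, p, s,
      ⟨hs1.symm, hs2.symm⟩, ?_, hp2, hp3⟩
    exact (row ⟨x, hx⟩ s hs1 hs2).symm.trans hp1.symm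

end IsNet

end Net

/-! ### The formulas for the recovered Latin square -/

namespace Formula

variable {c : ℕ}

def or (φ ψ : Formula c) : Formula c := not (and (not φ) (not ψ))

def any : List (Formula c) → Formula c
  | [] => num fun _ => false
  | φ :: l => or φ (any l)

def eq (x y : Fin c) : Formula c := num fun a => decide (a x = a y)

def lt (x y : Fin c) : Formula c := num fun a => decide (a x < a y)

/-- The numbers `x` and `y` have a common binary digit `1`. -/
def meet (x y : Fin c) : Formula c := num fun a => decide (a x &&& a y ≠ 0)

section

variable {m : ℕ} {A : Fin m → Fin m → Prop} {a : Fin c → Fin m}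

@[simp] theorem eval_adj {x y : Fin c} : (adj x y).eval A a ↔ A (a x) (a y) := Iff.rfl

@[simp] theorem eval_num {p : (Fin c → ℕ) → Bool} :
    (num p).eval A a ↔ p (fun x => a x) = true := Iff.rfl

@[simp] theorem eval_not {φ : Formula c} : φ.not.eval A a ↔ ¬ φ.eval A a := Iff.rfl

@[simp] theorem eval_and {φ ψ : Formula c} :
    (φ.and ψ).eval A a ↔ φ.eval A a ∧ ψ.eval A a := Iff.rfl

@[simp] theorem eval_ex {x : Fin c} {φ : Formula c} :
    (ex x φ).eval A a ↔ ∃ i, φ.eval A (Function.update a x i) := Iff.rfl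

@[simp] theorem eval_or {φ ψ : Formula c} :
    (φ.or ψ).eval A a ↔ φ.eval A a ∨ ψ.eval A a := by
  simp only [or, eval_not, eval_and]; tauto

@[simp] theorem eval_any {l : List (Formula c)} :
    (any l).eval A a ↔ ∃ φ ∈ l, φ.eval A a := by
  induction l with
  | nil => simp [any]
  | cons φ l ih => simp [any, ih]

@[simp] theorem eval_eq {x y : Fin c} : (eq x y).eval A a ↔ a x = a y := by
  simp [eq, Fin.ext_iff]

@[simp] theorem eval_lt {x y : Fin c} : (lt x y).eval A a ↔ a x < a y := by
  simp [lt]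

@[simp] theorem eval_meet {x y : Fin c} :
    (meet x y).eval A a ↔ (a x : ℕ) &&& (a y : ℕ) ≠ 0 := by
  simp [meet]

end

theorem isUniform_eq (x y : Fin c) : (eq x y).IsUniform :=
  ⟨.equal (.inl x) (.inl y), fun W _ h => SweepOp.run_equal W _ _ true (h _) (h _)⟩

theorem isUniform_lt (x y : Fin c) : (lt x y).IsUniform :=
  ⟨.compare false (.inl x) (.inl y), fun W _ h => SweepOp.run_compare W _ _ false false (h _) (h _)⟩

theorem isUniform_meet (x y : Fin c) : (meet x y).IsUniform :=
  ⟨.meet (.inl x) (.inl y), fun W _ h => SweepOp.run_meet W _ _ false (h _)⟩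

end Formula

namespace LatinFormula

open Formula

/-- The variables `11` and `12` are reserved for bound variables. -/
def onLine (p q w : Fin 13) : Formula 13 :=
  or (or (eq w p) (eq w q)) (and (and (adj w p) (adj w q))
    (ex 11 (ex 12 (and (not (eq 11 12)) (and (and (adj 11 p) (and (adj 11 q) (adj 11 w)))
      (and (adj 12 p) (and (adj 12 q) (adj 12 w))))))))

/-- The variable `10` is reserved for a bound variable. -/
def sameClass (o u p q : Fin 13) : Formula 13 :=
  or (eq p q) (and (adj p q) (or (and (onLine p q o) (onLine p q u))
    (not (ex 10 (and (onLine o u 10) (onLine p q 10))))))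

def thirdClass (o u v p q : Fin 13) : Formula 13 :=
  or (eq p q) (and (adj p q) (and (not (sameClass o u p q)) (not (sameClass o v p q))))

/-- The variables `7` and `8` are reserved for bound variables. -/
def entry (o u v x y z : Fin 13) : Formula 13 :=
  and (and (sameClass o u o x) (and (sameClass o u o y) (sameClass o u o z)))
    (ex 7 (ex 8 (and (and (sameClass o v o 8) (thirdClass o u v x 8))
      (and (sameClass o u 8 7) (and (sameClass o v 7 y) (thirdClass o u v 7 z))))))

/-- The variable `4` is the first vertex, and `5` is its first neighbour. -/
def base : Formula 13 :=
  and (not (ex 9 (lt 9 4))) (and (adj 4 5) (not (ex 9 (and (adj 4 9) (lt 9 5)))))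

/-- The variable `6` is the first neighbour of `4` that is not on the line through `4` and `5`. -/
def second : Formula 13 :=
  and (and (adj 4 6) (not (sameClass 4 5 4 6)))
    (not (ex 9 (and (and (adj 4 9) (not (sameClass 4 5 4 9))) (lt 9 6))))

/-- The variable `0` belongs to the index set of the recovered Latin square. -/
def index : Formula 13 :=
  ex 4 (ex 5 (and base (sameClass 4 5 4 0)))

/-- The entry in row `0` and column `1` has a common binary digit with the variable `2`. -/
def entryDigit : Formula 13 :=
  ex 4 (ex 5 (ex 6 (and (and base second) (ex 3 (and (entry 4 5 6 0 1 3) (meet 3 2))))))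

/-! ### Uniformity and meaning of the formulas -/

theorem isUniform_onLine (p q w : Fin 13) : (onLine p q w).IsUniform := by
  simp only [onLine, Formula.or, Formula.IsUniform, isUniform_eq, and_self]

theorem isUniform_sameClass (o u p q : Fin 13) : (sameClass o u p q).IsUniform := by
  simp only [sameClass, Formula.or, Formula.IsUniform, isUniform_eq, isUniform_onLine, and_self]

theorem isUniform_thirdClass (o u v p q : Fin 13) : (thirdClass o u v p q).IsUniform := by
  simp only [thirdClass, Formula.or, Formula.IsUniform, isUniform_eq, isUniform_sameClass, and_self]

theorem isUniform_entry (o u v x y z : Fin 13) : (entry o u v x y z).IsUniform := by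
  simp only [entry, Formula.IsUniform, isUniform_sameClass, isUniform_thirdClass, and_self]

theorem isUniform_base : base.IsUniform := by
  simp only [base, Formula.IsUniform, isUniform_lt, and_self]

theorem isUniform_second : second.IsUniform := by
  simp only [second, Formula.IsUniform, isUniform_lt, isUniform_sameClass, and_self]

theorem isUniform_index : index.IsUniform := by
  simp only [index, Formula.IsUniform, isUniform_base, isUniform_sameClass, and_self]

theorem isUniform_entryDigit : entryDigit.IsUniform := by
  simp only [entryDigit, Formula.IsUniform, isUniform_base, isUniform_second, isUniform_entry,
    isUniform_meet, and_self]

section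

variable {m : ℕ} {A : Fin m → Fin m → Prop} {a : Fin 13 → Fin m}

/-- The bounds keep the arguments away from the reserved bound variables, so no variable is
captured; the same holds for the formulas built on this one. -/
theorem eval_onLine {p q w : Fin 13} (hp : p < 11) (hq : q < 11) (hw : w < 11) :
    (onLine p q w).eval A a ↔ OnLine A (a p) (a q) (a w) := by
  have h1 : p ≠ 11 := hp.ne
  have h2 : q ≠ 11 := hq.ne
  have h3 : w ≠ 11 := hw.ne
  have h4 : p ≠ 12 := (hp.trans (by decide)).ne
  have h5 : q ≠ 12 := (hq.trans (by decide)).ne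
  have h6 : w ≠ 12 := (hw.trans (by decide)).ne
  have h7 : (11 : Fin 13) ≠ 12 := by decide
  simp [onLine, OnLine, h1, h2, h3, h4, h5, h6, h7]

theorem eval_sameClass {o u p q : Fin 13} (ho : o < 10) (hu : u < 10) (hp : p < 10) (hq : q < 10) :
    (sameClass o u p q).eval A a ↔ SameClass A (a o) (a u) (a p) (a q) := by
  have h : (10 : Fin 13) < 11 := by decide
  simp [sameClass, SameClass, eval_onLine, ho.trans h, hu.trans h, hp.trans h, hq.trans h, h, ho.ne,
    hu.ne, hp.ne, hq.ne]

theorem eval_thirdClass {o u v p q : Fin 13} (ho : o < 10) (hu : u < 10) (hv : v < 10) (hp : p < 10)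
    (hq : q < 10) :
    (thirdClass o u v p q).eval A a ↔ ThirdClass A (a o) (a u) (a v) (a p) (a q) := by
  simp [thirdClass, ThirdClass, eval_sameClass, *]

theorem eval_entry {o u v x y z : Fin 13} (ho : o < 7) (hu : u < 7) (hv : v < 7) (hx : x < 7)
    (hy : y < 7) (hz : z < 7) :
    (entry o u v x y z).eval A a ↔ Entry A (a o) (a u) (a v) (a x) (a y) (a z) := by
  have h : (7 : Fin 13) < 10 := by decide
  have h' : (8 : Fin 13) < 10 := by decide
  have h8 : (7 : Fin 13) < 8 := by decide
  simp [entry, Entry, eval_sameClass, eval_thirdClass, ho.trans h, hu.trans h, hv.trans h,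
    hx.trans h, hy.trans h, hz.trans h, h, h', ho.ne, hu.ne, hv.ne, hx.ne, hy.ne, hz.ne,
    (ho.trans h8).ne, (hu.trans h8).ne, (hv.trans h8).ne, (hx.trans h8).ne, (hy.trans h8).ne,
    (hz.trans h8).ne, h8.ne]

/-- The numerical order makes the choice of `o`, `u` and later `v` unique, so the existential
quantifiers in the formulas always find the same points. -/
def IsBase {m : ℕ} (A : Fin m → Fin m → Prop) (o u : Fin m) : Prop :=
  (∀ w, o ≤ w) ∧ A o u ∧ ∀ w, A o w → u ≤ w

def IsSecond {m : ℕ} (A : Fin m → Fin m → Prop) (o u v : Fin m) : Prop :=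
  (A o v ∧ ¬ SameClass A o u o v) ∧ ∀ w, A o w → ¬ SameClass A o u o w → v ≤ w

theorem eval_base : base.eval A a ↔ IsBase A (a 4) (a 5) := by
  simp [base, IsBase]

theorem eval_second : second.eval A a ↔ IsSecond A (a 4) (a 5) (a 6) := by
  simp [second, IsSecond, eval_sameClass]

theorem eval_index : index.eval A a ↔ ∃ o u, IsBase A o u ∧ SameClass A o u o (a 0) := by
  simp [index, eval_base, eval_sameClass]

theorem eval_entryDigit : entryDigit.eval A a ↔ ∃ o u v, (IsBase A o u ∧ IsSecond A o u v) ∧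
    ∃ z, Entry A o u v (a 0) (a 1) z ∧ (z : ℕ) &&& (a 2 : ℕ) ≠ 0 := by
  simp [entryDigit, eval_base, eval_second, eval_entry]

end

end LatinFormula

/-! ### Recovery of Latin squares by formulas -/

section Recovery

/-- The functions `f` and `g` describe the digits of a Latin square that is recovered from `G`. -/
def Describes {n : ℕ} (G : SimpleGraph (Fin (n ^ 2))) (f : ℕ → Bool) (g : ℕ → ℕ → ℕ → Bool) :
    Prop :=
  ∃ (S : Finset (Fin (n ^ 2))) (L : S → S → S), G.IsNClique n S ∧ IsLatinSquare L ∧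
    Nonempty (G ≃g latinSquareGraph L) ∧ (∀ u : Fin (n ^ 2), f u = true ↔ u ∈ S) ∧
    ∀ (u w : Fin (n ^ 2)) (k : ℕ), g u w k = true ↔
      ∃ (hu : u ∈ S) (hw : w ∈ S), ((L ⟨u, hu⟩ ⟨w, hw⟩ : Fin (n ^ 2)) : ℕ) &&& k ≠ 0

/-- Numbers that are not vertices get the value `false`, which extends the digit functions to all of
`ℕ`. -/
theorem exists_describes {n : ℕ} {G : SimpleGraph (Fin (n ^ 2))} {S : Finset (Fin (n ^ 2))}
    {L : S → S → S} (h1 : G.IsNClique n S) (h2 : IsLatinSquare L)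
    (h3 : Nonempty (G ≃g latinSquareGraph L)) : ∃ f g, Describes G f g ∧
      (∀ u : Fin (n ^ 2), f u = true ↔ u ∈ S) ∧
      ∀ (u w : Fin (n ^ 2)) (k : ℕ), g u w k = true ↔
        ∃ (hu : u ∈ S) (hw : w ∈ S), ((L ⟨u, hu⟩ ⟨w, hw⟩ : Fin (n ^ 2)) : ℕ) &&& k ≠ 0 := by
  classical
  have hf : ∀ u : Fin (n ^ 2), decide (∃ h : (u : ℕ) < n ^ 2, (⟨u, h⟩ : Fin (n ^ 2)) ∈ S) = true ↔
      u ∈ S := by simp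
  have hg : ∀ (u w : Fin (n ^ 2)) (k : ℕ), decide (∃ (hu' : (u : ℕ) < n ^ 2) (hw' : (w : ℕ) < n ^ 2)
      (hu : (⟨u, hu'⟩ : Fin (n ^ 2)) ∈ S) (hw : (⟨w, hw'⟩ : Fin (n ^ 2)) ∈ S),
        ((L ⟨_, hu⟩ ⟨_, hw⟩ : Fin (n ^ 2)) : ℕ) &&& k ≠ 0) = true ↔
      ∃ (hu : u ∈ S) (hw : w ∈ S), ((L ⟨u, hu⟩ ⟨w, hw⟩ : Fin (n ^ 2)) : ℕ) &&& k ≠ 0 := by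
    intro u w k
    simp
  exact ⟨fun u => decide (∃ h : u < n ^ 2, (⟨u, h⟩ : Fin (n ^ 2)) ∈ S),
    fun u w k => decide (∃ (hu' : u < n ^ 2) (hw' : w < n ^ 2)
      (hu : (⟨u, hu'⟩ : Fin (n ^ 2)) ∈ S) (hw : (⟨w, hw'⟩ : Fin (n ^ 2)) ∈ S),
        ((L ⟨_, hu⟩ ⟨_, hw⟩ : Fin (n ^ 2)) : ℕ) &&& k ≠ 0),
    ⟨S, L, h1, h2, h3, hf, hg⟩, hf, hg⟩

/-- On the graph of a Latin square of order `n`, the formulas define a recovered Latin square. -/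
def Recovers {c : ℕ} (n : ℕ) (x y z : Fin c) (φ ψ : Formula c) : Prop :=
  ∀ L : Fin n → Fin n → Fin n, IsLatinSquare L → ∀ G : SimpleGraph (Fin (n ^ 2)),
    Nonempty (G ≃g latinSquareGraph L) → ∃ f g, Describes G f g ∧
      (∀ a, φ.eval G.Adj a ↔ f (a x) = true) ∧
      ∀ a, ψ.eval G.Adj a ↔ g (a x) (a y) (a z) = true

theorem exists_isLeast_fin {m : ℕ} {P : Fin m → Prop} (h : ∃ x, P x) :
    ∃ x, P x ∧ ∀ y, P y → x ≤ y := by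
  obtain ⟨x, hx, hm⟩ := Set.exists_min_image {x | P x} id (Set.toFinite _) h
  exact ⟨x, hx, hm⟩

open LatinFormula in
theorem recovers_of_five_le {n : ℕ} (hn : 5 ≤ n) : Recovers n 0 1 2 index entryDigit := by
  intro L hL G ⟨iso⟩
  have hQ : 5 ≤ Nat.card (Fin n) := by simpa using hn
  obtain ⟨a, b, c, net⟩ := exists_isNet hL iso
  have : Nontrivial (Fin n) := Fin.nontrivial_iff_two_le.2 (by omega)
  have hm : 0 < n ^ 2 := by positivity
  obtain ⟨o, -, ho⟩ := exists_isLeast_fin (m := n ^ 2) (P := fun _ => True) ⟨⟨0, hm⟩, trivial⟩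
  have exists_adj : ∀ {a b c : Fin (n ^ 2) → Fin n}, IsNet G a b c →
      ∃ w, G.Adj o w ∧ b o = b w ∧ a o ≠ a w := by
    intro a b c net
    obtain ⟨t, ht⟩ := exists_ne (a o)
    obtain ⟨w, hw1, hw2⟩ := net.exists_point t (b o)
    refine ⟨w, (net.adj _ _).2 ⟨?_, Or.inr (Or.inl hw2.symm)⟩, hw2.symm, hw1 ▸ ht.symm⟩
    rintro rfl
    exact ht hw1.symm
  obtain ⟨u, hu, hu'⟩ := exists_isLeast_fin (P := fun w => G.Adj o w)
    (let ⟨w, hw, _⟩ := exists_adj net; ⟨w, hw⟩)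
  have hbase : IsBase G.Adj o u := ⟨fun w => ho w trivial, hu, hu'⟩
  -- The coordinates are renamed such that the line `ou` belongs to the first class, and below such
  -- that `ov` belongs to the second.
  obtain ⟨a, b, c, net, ha⟩ : ∃ a b c : Fin (n ^ 2) → Fin n, IsNet G a b c ∧ a o = a u := by
    rcases ((net.adj _ _).1 hu).2 with h | h | h
    · exact ⟨a, b, c, net, h⟩
    · exact ⟨b, c, a, net.rotate, h⟩
    · exact ⟨c, a, b, net.rotate.rotate, h⟩
  have hsame := net.sameClass_iff hQ hu ha
  obtain ⟨v, ⟨hv, hv'⟩, hv''⟩ := exists_isLeast_fin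
    (P := fun w => G.Adj o w ∧ ¬ SameClass G.Adj o u o w)
    (let ⟨w, hw, _, hw'⟩ := exists_adj net; ⟨w, hw, fun h => hw' ((hsame _ _).1 h)⟩)
  have hsecond : IsSecond G.Adj o u v := ⟨⟨hv, hv'⟩, fun w h h' => hv'' w ⟨h, h'⟩⟩
  obtain ⟨b, c, net, hb⟩ : ∃ b c : Fin (n ^ 2) → Fin n, IsNet G a b c ∧ b o = b v := by
    rw [hsame] at hv'
    rcases ((net.adj _ _).1 hv).2.resolve_left hv' with h | h
    · exact ⟨b, c, net, h⟩
    · exact ⟨c, b, net.rotate.rotate.swap, h⟩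
  have base_unique : ∀ {o' u'}, IsBase G.Adj o' u' → o' = o ∧ u' = u := by
    intro o' u' h
    obtain rfl : o' = o := le_antisymm (h.1 _) (hbase.1 _)
    exact ⟨rfl, le_antisymm (h.2.2 _ hu) (hu' _ h.2.1)⟩
  set S : Finset (Fin (n ^ 2)) := {x | a x = a o} with hS
  have hS : ∀ x, x ∈ S ↔ a x = a o := by simp [hS]
  obtain ⟨L', h1, h2, h3⟩ := net.exists_latinSquare_entry hQ hu ha hv hb hS
  obtain ⟨f, g, hd, hf, hg⟩ := exists_describes (net.isNClique o hS) h1 h2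
  refine ⟨f, g, hd, fun e => ?_, fun e => ?_⟩
  · rw [eval_index, hf, hS]
    constructor
    · rintro ⟨o', u', h, h'⟩
      obtain ⟨rfl, rfl⟩ := base_unique h
      exact ((hsame _ _).1 h').symm
    · exact fun h => ⟨o, u, hbase, (hsame _ _).2 h.symm⟩
  · rw [eval_entryDigit, hg]
    constructor
    · rintro ⟨o', u', v', ⟨h, h'⟩, z, hz, hz'⟩
      obtain ⟨rfl, rfl⟩ := base_unique h
      obtain rfl : v' = v := le_antisymm (h'.2 _ hv hv') (hsecond.2 _ h'.1.1 h'.1.2)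
      obtain ⟨hx, hy, rfl⟩ := (h3 _ _ _).1 hz
      exact ⟨hx, hy, hz'⟩
    · rintro ⟨hx, hy, hz⟩
      exact ⟨o, u, v, ⟨hbase, hsecond⟩, _, (h3 _ _ _).2 ⟨hx, hy, rfl⟩, hz⟩

/-- Here nothing has to be definable: any line serves as clique and any bijection with `Fin n` as
naming, so no lower bound on `n` is needed. -/
theorem exists_describes_of_iso {n : ℕ} {L : Fin n → Fin n → Fin n} (hL : IsLatinSquare L)
    {G : SimpleGraph (Fin (n ^ 2))} (iso : G ≃g latinSquareGraph L) : ∃ f g, Describes G f g := by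
  obtain ⟨a, b, c, net⟩ := exists_isNet hL iso
  obtain ⟨S, hS⟩ : ∃ S, G.IsNClique n S := by
    rcases Nat.eq_zero_or_pos n with rfl | hn
    · exact ⟨∅, by simp⟩
    · exact ⟨({x | a x = a ⟨0, by positivity⟩} : Finset (Fin (n ^ 2))),
        net.isNClique ⟨0, by positivity⟩ (by simp)⟩
  have e := S.equivFinOfCardEq hS.card_eq
  obtain ⟨L', h1, h2, -⟩ := net.exists_latinSquare e e e
  obtain ⟨f, g, h, -⟩ := exists_describes hS h1 h2
  exact ⟨f, g, h⟩

open Formula in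
/-- The graph is `G`. -/
noncomputable def isGraph {m : ℕ} (G : SimpleGraph (Fin m)) : Formula 13 :=
  open Classical in
  let same : Formula 13 :=
    num fun a => decide (∃ (h3 : a 3 < m) (h4 : a 4 < m), G.Adj ⟨a 3, h3⟩ ⟨a 4, h4⟩)
  not (ex 3 (ex 4 (not (or (and (adj 3 4) same) (and (not (adj 3 4)) (not same))))))

theorem eval_isGraph {m : ℕ} (G H : SimpleGraph (Fin m)) (a : Fin 13 → Fin m) :
    (isGraph G).eval H.Adj a ↔ G = H := by
  constructor
  · intro h
    ext u w
    by_contra hne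
    simp only [isGraph, Formula.eval_not, Formula.eval_ex] at h
    refine h ⟨u, w, ?_⟩
    simp
    tauto
  · rintro rfl
    simp [isGraph, em]

-- For fixed `n` there are finitely many graphs on `n ^ 2` vertices. The formulas test which of them
-- is given and look up the digits of a square chosen for it. Their numerical predicates are
-- arbitrary, so they are used for finitely many `n` only.
open Formula in
theorem exists_recovers (n : ℕ) : ∃ φ ψ : Formula 13, Recovers n 0 1 2 φ ψ := by
  classical
  have key : ∀ G : SimpleGraph (Fin (n ^ 2)), ∃ f g, (∃ L : Fin n → Fin n → Fin n,
      IsLatinSquare L ∧ Nonempty (G ≃g latinSquareGraph L)) → Describes G f g := by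
    intro G
    by_cases h : ∃ L : Fin n → Fin n → Fin n, IsLatinSquare L ∧ Nonempty (G ≃g latinSquareGraph L)
    · obtain ⟨L, hL, ⟨iso⟩⟩ := h
      obtain ⟨f, g, h⟩ := exists_describes_of_iso hL iso
      exact ⟨f, g, fun _ => h⟩
    · exact ⟨fun _ => false, fun _ _ _ => false, fun h' => absurd h' h⟩
  choose f g hfg using key
  refine ⟨any ((Finset.univ : Finset (SimpleGraph (Fin (n ^ 2)))).toList.map fun G =>
      and (isGraph G) (num fun a => f G (a 0))),
    any ((Finset.univ : Finset (SimpleGraph (Fin (n ^ 2)))).toList.map fun G =>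
      and (isGraph G) (num fun a => g G (a 0) (a 1) (a 2))), ?_⟩
  intro L hL G hG
  refine ⟨f G, g G, hfg G ⟨L, hL, hG⟩, fun a => ?_, fun a => ?_⟩
  · simp [eval_isGraph]
  · simp [eval_isGraph]

end Recovery

/-! ### The circuit family -/

/-- The circuit works with `(n ^ 2 * n ^ 2).sqrt` vertices, which equals `n ^ 2` only
propositionally. -/
theorem Formula.eval_cast {c m m' : ℕ} (e : m = m') {A : Fin m → Fin m → Prop}
    {A' : Fin m' → Fin m' → Prop} (h : ∀ u w, A u w ↔ A' (Fin.cast e u) (Fin.cast e w))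
    (φ : Formula c) (a : Fin c → Fin m) :
    φ.eval A a ↔ φ.eval A' fun x => Fin.cast e (a x) := by
  subst e
  obtain rfl : A = A' := by
    funext u w
    exact propext (h u w)
  rfl

theorem latinSquareString_eq {m : ℕ} {S : Finset (Fin m)} {L : S → S → S} {f : ℕ → Bool}
    {g : ℕ → ℕ → ℕ → Bool} (hf : ∀ u : Fin m, f u = true ↔ u ∈ S)
    (hg : ∀ (u w : Fin m) (k : ℕ), g u w k = true ↔
      ∃ (hu : u ∈ S) (hw : w ∈ S), ((L ⟨u, hu⟩ ⟨w, hw⟩ : Fin m) : ℕ) &&& k ≠ 0) :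
    (List.range m).map f ++ ((List.range m).flatMap fun u => (List.range m).flatMap fun w =>
      (List.range (Nat.clog 2 m)).map fun b => g u w (2 ^ b)) = latinSquareString S L := by
  -- Sharing a digit with a power of two means having that digit; this is how a formula reads a
  -- single output bit.
  have htest : ∀ k b : ℕ, k &&& 2 ^ b ≠ 0 ↔ k.testBit b = true := by
    intro k b
    rw [Nat.and_two_pow]
    cases k.testBit b <;> simp
  rw [latinSquareString, ← List.map_coe_finRange_eq_range]
  simp only [List.map_map, List.flatMap_map]
  congr 1
  · refine List.map_congr_left fun u _ => ?_
    rw [Bool.eq_iff_iff, Function.comp_apply, hf]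
    simp
  · refine List.flatMap_congr fun u _ => List.flatMap_congr fun w _ => ?_
    rw [binaryDigits]
    refine List.map_congr_left fun b _ => ?_
    rw [Bool.eq_iff_iff, hg]
    simp only [htest]
    split_ifs with h
    · exact ⟨fun ⟨_, _, h'⟩ => h', fun h' => ⟨h.1, h.2, h'⟩⟩
    · simp only [Nat.zero_testBit, Bool.false_eq_true, iff_false]
      exact fun ⟨h1, h2, _⟩ => h ⟨h1, h2⟩

theorem queryCircuit_recovers {c n : ℕ} {x y z : Fin c} (hxy : x ≠ y) (hxz : x ≠ z) (hyz : y ≠ z)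
    {φ ψ : Formula c} (h : Recovers n x y z φ ψ) {L : Fin n → Fin n → Fin n} (hL : IsLatinSquare L)
    {G : SimpleGraph (Fin (n ^ 2))} (hG : Nonempty (G ≃g latinSquareGraph L)) :
    ∃ (S : Finset (Fin (n ^ 2))) (L' : S → S → S), G.IsNClique n S ∧ IsLatinSquare L' ∧
      Nonempty (G ≃g latinSquareGraph L') ∧
        (queryCircuit (n ^ 2 * n ^ 2) x y z φ ψ).eval (adjacencyString G) =
          latinSquareString S L' := by
  obtain ⟨f, g, ⟨S, L', h1, h2, h3, hf, hg⟩, hφ, hψ⟩ := h L hL G hG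
  refine ⟨S, L', h1, h2, h3, ?_⟩
  have e : (n ^ 2 * n ^ 2).sqrt = n ^ 2 := Nat.sqrt_eq _
  have hA : ∀ u w, inputRel (adjacencyString G) u w ↔ G.Adj (Fin.cast e u) (Fin.cast e w) := by
    intro u w
    have hlt : (u : ℕ) * (n ^ 2 * n ^ 2).sqrt + w < n ^ 2 * n ^ 2 := by
      have h1 := Nat.mul_le_mul_right (n ^ 2) (Nat.succ_le_iff.2 (u.2.trans_eq e))
      have h2 : (w : ℕ) < n ^ 2 := w.2.trans_eq e
      rw [Nat.succ_mul] at h1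
      have h3 : (u : ℕ) * (n ^ 2 * n ^ 2).sqrt = u * n ^ 2 := congrArg _ e
      rw [h3]
      omega
    have hi : (⟨(u : ℕ) * (n ^ 2 * n ^ 2).sqrt + w, hlt⟩ : Fin (n ^ 2 * n ^ 2)) =
        finProdFinEquiv (Fin.cast e u, Fin.cast e w) := by
      apply Fin.ext
      simp only [finProdFinEquiv_apply_val, Fin.val_cast, e]
      ring
    simp only [inputRel, hlt, exists_true_left, hi, adjacencyString, Equiv.symm_apply_apply,
      decide_eq_true_eq]
  rw [queryCircuit_eval _ hxy hxz hyz φ ψ _ f g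
    (fun a => (Formula.eval_cast e hA φ a).trans (hφ _))
    (fun a => (Formula.eval_cast e hA ψ a).trans (hψ _)), e]
  exact latinSquareString_eq hf hg

/-- Heights and numbers of nodes are constant from the threshold on, so the finitely many table
formulas do not spoil the uniform bounds. -/
theorem exists_bound_of_eventually_const {f : ℕ → ℕ} {B k : ℕ} (h : ∀ N, B ≤ N → f N = k) :
    ∃ d, ∀ N, f N ≤ d := by
  refine ⟨k + ∑ i ∈ Finset.range B, f i, fun N => ?_⟩
  by_cases hN : B ≤ N
  · rw [h N hN]; omega
  · exact (Finset.single_le_sum (fun _ _ => Nat.zero_le _)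
      (Finset.mem_range.2 (not_le.1 hN))).trans (Nat.le_add_left _ _)

theorem mainTheorem8 :
    ∃ C : (N : ℕ) → Circuit N, IsUniformAC0 C ∧
      ∀ (n : ℕ) (L : Fin n → Fin n → Fin n), IsLatinSquare L →
        ∀ G : SimpleGraph (Fin (n ^ 2)), Nonempty (G ≃g latinSquareGraph L) →
          ∃ (S : Finset (Fin (n ^ 2))) (L' : S → S → S),
            G.IsNClique n S ∧ IsLatinSquare L' ∧ Nonempty (G ≃g latinSquareGraph L') ∧
            (C (n ^ 2 * n ^ 2)).eval (adjacencyString G) = latinSquareString S L' := by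
  choose φ₀ ψ₀ h₀ using exists_recovers
  -- The threshold is the input length for `n = 5`. Below it, `n` is recovered as the fourth root of
  -- `N`; the output for lengths that are not fourth powers is irrelevant.
  set φ : ℕ → Formula 13 := fun N =>
    if 5 ^ 2 * 5 ^ 2 ≤ N then LatinFormula.index else φ₀ N.sqrt.sqrt with hφ
  set ψ : ℕ → Formula 13 := fun N =>
    if 5 ^ 2 * 5 ^ 2 ≤ N then LatinFormula.entryDigit else ψ₀ N.sqrt.sqrt with hψ
  have hφ' : ∀ N, 5 ^ 2 * 5 ^ 2 ≤ N → φ N = LatinFormula.index := fun N h => if_pos h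
  have hψ' : ∀ N, 5 ^ 2 * 5 ^ 2 ≤ N → ψ N = LatinFormula.entryDigit := fun N h => if_pos h
  refine ⟨fun N => queryCircuit N 0 1 2 (φ N) (ψ N), ⟨?_, ?_, ?_, ?_⟩, ?_⟩
  · exact fun N => queryCircuit_wellFormed _ _ _ _ _ _
  · obtain ⟨d, hd⟩ := exists_bound_of_eventually_const (f := fun N => max (φ N).height (ψ N).height)
      (fun N h => by rw [hφ' N h, hψ' N h])
    exact ⟨d, fun N => (queryCircuit_depth_le _ _ _ _ _ _).trans (hd N)⟩
  · obtain ⟨k, hk⟩ := exists_bound_of_eventually_const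
      (f := fun N => (φ N).nodes + (ψ N).nodes + 13) (fun N h => by rw [hφ' N h, hψ' N h])
    exact ⟨k, fun N => queryCircuit_size_le _ _ _ _ _ _ (hk N)⟩
  · exact logspaceUniform_of_eventually_queryCircuit (x := 0) (y := 1) (z := 2) (by decide)
      (by decide) (by decide)
      LatinFormula.isUniform_index LatinFormula.isUniform_entryDigit
      (fun N h => by rw [hφ' N h, hψ' N h])
  · intro n L hL G hG
    refine queryCircuit_recovers (by decide) (by decide) (by decide) ?_ hL hG
    by_cases hn : 5 ≤ n
    · have h2 : 5 ^ 2 ≤ n ^ 2 := Nat.pow_le_pow_left hn 2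
      rw [hφ' _ (Nat.mul_le_mul h2 h2), hψ' _ (Nat.mul_le_mul h2 h2)]
      exact recovers_of_five_le hn
    · have h2 : ¬ 5 ^ 2 * 5 ^ 2 ≤ n ^ 2 * n ^ 2 := by
        have h3 : n ^ 2 < 5 ^ 2 := Nat.pow_lt_pow_left (by omega) (by norm_num)
        have := Nat.mul_lt_mul'' h3 h3
        omega
      have e : (n ^ 2 * n ^ 2).sqrt.sqrt = n := by rw [Nat.sqrt_eq, Nat.sqrt_eq']
      simp only [hφ, hψ, h2, if_false, e]
      exact h₀ n
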